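/- Write $\mathbb R^3=\mathbb C\times\mathbb R$ and $\langle w_1,w_2\rangle=\operatorname{Re}(w_1\overline{w_2})$ for $w_1,w_2\in\mathbb C$, so that $\langle 1,w\rangle=\operatorname{Re}w$ and $\langle i,w\rangle=\operatorname{Im}w$. Subscripts $_{,1},{}_{,2}$ are the partial derivatives in the coordinates of $z=u_1+iu_2$. Let $\Sigma$ be a Riemann surface, $X:\Sigma\to\mathbb R^3$ a smooth immersion and $N$ a smooth unit normal field (Gauss map) of $X$. Let $W$ be the Weingarten matrix, $N_{,i}=\sum_j W_{ij}X_{,j}$, let $K=\det W$ and $H=-\tfrac12\operatorname{tr}W$ be the Gauss--Kronecker and mean curvatures, and put $\psi=\langle X,N\rangle$, $\Lambda=\langle X,X\rangle$. Assume $K\ne0$ everywhere. $X(\Sigma)$ is called an SS-surface if $$2\psi H+(\Lambda+\psi^2)K=0\quad\text{on }\Sigma .$$ (The relation does not depend on the choice of $N$.) Where $\psi\neq0$, put $N^+=\operatorname{sign}(\psi)N$, the unit normal with $\langle X,N^+\rangle>0$. For $f,g$ holomorphic on an open set $U\subset\mathbb C$ with $g'\ne0$ on $U$ put $T=1+|g|^2$,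 $h=e^{\langle1,f\rangle}=e^{\operatorname{Re}f}$ and $$N_g=\frac{(2g,\,2-T)}{T},\qquad X_{f,g}=\frac{e^{\langle 1,f\rangle}}{2|g'|^2}\Big(Tg'\overline{f'}-2g\langle g',gf'\rangle,\;-2\langle g',gf'\rangle\Big)+e^{\langle1,f\rangle}N_g ,$$ $\xi=f'\Big(\dfrac{g''}{g'}-\dfrac2Tg'\overline g\Big)-f''$, and let $V$ be the matrix $$V_{ij}=\frac1{L_{jj}}\Big(h_{,ij}-\sum_k h_{,k}\Gamma_{ij}^k+hL_{ij}\delta_{ij}\Big),$$ where $\Gamma_{ij}^k$ are the Christoffel symbols of the metric $L_{ij}=\langle (N_g)_{,i},(N_g)_{,j}\rangle$. 1. $X(\Sigma)$ is an SS-surface if and only if every point $p\in\Sigma$ with $\psi(p)\ne0$ and $N^+(p)\neq(0,0,-1)$ lies in an open set $\varphi(U)\subset\Sigma$, where $U\subset\mathbb C$ is open and $\varphi:U\to\varphi(U)$ is a diffeomorphism, on which $X\circ\varphi=X_{f,g}$ for some holomorphic $f,g:U\to\mathbb C$ with $g'\ne0$. 2. For every such local representation $X\circ\varphi=X_{f,g}$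 on $U$ one has, at each point of $U$: the SS relation holds; $\psi\circ\varphi\ne0$; the Gauss map is $N^+\circ\varphi=N_g$; the support function is $|\psi\circ\varphi|=\langle X\circ\varphi,N^+\circ\varphi\rangle=h$; and $\det V=1/(K\circ\varphi)\ne0$. 3. Let $\varphi$ be a diffeomorphism from an open set $U\subset\mathbb C$ onto an open subset of $\Sigma$ such that $N\circ\varphi$ is conformal, and put $\tilde h=\psi\circ\varphi$. At each point of $U$, the SS relation is equivalent to $\tilde h\,\Delta\tilde h-|\nabla\tilde h|^2=0$ (Euclidean Laplacian and gradient). If $\tilde h$ has no zero on $U$, the SS relation holds on all of $\varphi(U)$ if and only if $\log|\tilde h|$ is harmonic on $U$. 4. For all $f,g$ holomorphic on an open set $U\subset\mathbb C$ with $g'\ne0$: $X=X_{f,g}$ and $N=N_g$ are smooth, $|N|=1$, $\langle X_{,i},N\rangle=0$, $\langle X,N\rangle=h$; the differential of $X$ is injective at $z$ if and only if $\det V(z)\ne0$, and then $\det V=1/K\neq 0$ at $z$. With $A=\langle1,f'\rangle^2-\langle1,\xi\rangle$, $B=\langle i,\xi-\tfrac{f'^2}2\rangle$, $C=\langle1,if'\rangle^2+\langle1,\xi\rangle$,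 the fundamental forms are $$\langle X_{,1},X_{,1}\rangle=\frac{T^2h^2}{4|g'|^2}(A^2+B^2)+2h^2A+\frac{4h^2|g'|^2}{T^2},\qquad \langle X_{,1},X_{,2}\rangle=\Big(\frac{T^2h^2|f'|^2}{4|g'|^2}+2h^2\Big)B,$$ $$\langle X_{,2},X_{,2}\rangle=\frac{T^2h^2}{4|g'|^2}(C^2+B^2)+2h^2C+\frac{4h^2|g'|^2}{T^2},$$ $$\langle X_{,1},N_{,1}\rangle=hA+\frac{4h|g'|^2}{T^2},\qquad \langle X_{,1},N_{,2}\rangle=hB,\qquad \langle X_{,2},N_{,2}\rangle=hC+\frac{4h|g'|^2}{T^2}.$$ -/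

import Mathlib

open scoped Manifold ContDiff ComplexConjugate

namespace SSSurface

noncomputable section

/-- Euclidean three-space. -/
abbrev E3 : Type := EuclideanSpace ℝ (Fin 3)

/-- The point `(w, t)` of `ℝ³ = ℂ × ℝ`. -/
def pt (w : ℂ) (t : ℝ) : E3 := !₂[w.re, w.im, t]

/-- The real basis `1, i` of `ℂ`, i.e. the directions of `u₁, u₂` in `z = u₁ + i u₂`. -/
def dir : Fin 2 → ℂ := ![1, Complex.I]

/-- Partial derivative with respect to `u_i` of a function of `z = u₁ + i u₂`. -/
def pd {F : Type*} [NormedAddCommGroup F] [NormedSpace ℝ F] (i : Fin 2) (u : ℂ → F) (z : ℂ) : F :=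
  fderiv ℝ u z (dir i)

/-! ### Surfaces in space -/

section Surface

variable {S : Type*} [TopologicalSpace S] [ChartedSpace ℂ S]

/-- The differential at `p` of a map from the (real two-dimensional) surface `S` to space. -/
def diff (Y : S → E3) (p : S) : ℂ →L[ℝ] E3 := mfderiv 𝓘(ℝ, ℂ) 𝓘(ℝ, E3) Y p

/-- The coordinate derivative `Y_{,i}` at `p`. -/
def coordDeriv (Y : S → E3) (p : S) (i : Fin 2) : E3 := diff Y p (dir i)

theorem coordDeriv_eq_pd (Y : ℂ → E3) (z : ℂ) (i : Fin 2) : coordDeriv Y z i = pd i Y z := by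
  simp only [coordDeriv, diff, pd, mfderiv_eq_fderiv]

/-- `X` is a smooth immersion of the surface in space. -/
structure IsImmersion (X : S → E3) : Prop where
  smooth : ContMDiff 𝓘(ℝ, ℂ) 𝓘(ℝ, E3) ∞ X
  injective : ∀ p, Function.Injective (diff X p)

/-- `N` is a (smooth, unit) normal Gauss map of `X`. -/
structure IsGaussMap (X N : S → E3) : Prop where
  smooth : ContMDiff 𝓘(ℝ, ℂ) 𝓘(ℝ, E3) ∞ N
  unit : ∀ p, ‖N p‖ = 1
  normal : ∀ p v, inner ℝ (diff X p v) (N p) = 0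

/-- First fundamental form `⟨X_{,i}, X_{,j}⟩`. -/
def firstForm (X : S → E3) (p : S) : Matrix (Fin 2) (Fin 2) ℝ :=
  Matrix.of fun i j => inner ℝ (coordDeriv X p i) (coordDeriv X p j)

/-- Second fundamental form, with the sign convention `⟨X_{,i}, N_{,j}⟩`. -/
def secondForm (X N : S → E3) (p : S) : Matrix (Fin 2) (Fin 2) ℝ :=
  Matrix.of fun i j => inner ℝ (coordDeriv X p i) (coordDeriv N p j)

/-- The Weingarten matrix `W`, characterised by `N_{,i} = ∑ j, W i j X_{,j}`
(see `weingarten_eq`). -/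
def weingarten (X N : S → E3) (p : S) : Matrix (Fin 2) (Fin 2) ℝ :=
  (secondForm X N p).transpose * (firstForm X p)⁻¹

theorem weingarten_eq (X N : S → E3) (p : S) (W : Matrix (Fin 2) (Fin 2) ℝ)
    (hI : IsUnit (firstForm X p).det)
    (hW : ∀ i, coordDeriv N p i = ∑ j, W i j • coordDeriv X p j) :
    weingarten X N p = W := by
  have h : (secondForm X N p).transpose = W * firstForm X p := by
    ext i k
    simp only [secondForm, firstForm, Matrix.transpose_apply, Matrix.of_apply, Matrix.mul_apply,
      hW i, Fin.sum_univ_two, inner_add_right, inner_smul_right]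
    rw [real_inner_comm (coordDeriv X p k) (coordDeriv X p 0),
      real_inner_comm (coordDeriv X p k) (coordDeriv X p 1)]
  rw [weingarten, h, Matrix.mul_assoc, Matrix.mul_nonsing_inv _ hI, Matrix.mul_one]

/-- Gauss–Kronecker curvature. -/
def gaussCurvature (X N : S → E3) (p : S) : ℝ := (weingarten X N p).det

/-- Mean curvature: half the trace of the shape operator `-dN`. -/
def meanCurvature (X N : S → E3) (p : S) : ℝ := -(weingarten X N p).trace / 2

/-- The support function `ψ = ⟨X, N⟩`. -/
def support (X N : S → E3) (p : S) : ℝ := inner ℝ (X p) (N p)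

/-- The quadratic distance function `Λ = ⟨X, X⟩`. -/
def quadDist (X : S → E3) (p : S) : ℝ := inner ℝ (X p) (X p)

/-- The relation `2ψH + (Λ + ψ²)K = 0` at the point `p`. -/
def SSAt (X N : S → E3) (p : S) : Prop :=
  2 * support X N p * meanCurvature X N p
    + (quadDist X p + support X N p ^ 2) * gaussCurvature X N p = 0

/-- `X(S)` is a surface of spherical type via support function. -/
def IsSS (X N : S → E3) : Prop := ∀ p, SSAt X N p

/-- Where `K ≠ 0`, the relation says that the sphere with centre `X + (H/K + ψ/2) N` and (signed)
radius `H/K + ψ/2` passes through the origin. -/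
theorem ssAt_iff_sphere (X N : S → E3) (p : S) (hN : ‖N p‖ = 1)
    (hK : gaussCurvature X N p ≠ 0) :
    SSAt X N p ↔
      ‖X p + (meanCurvature X N p / gaussCurvature X N p + support X N p / 2) • N p‖
        = |meanCurvature X N p / gaussCurvature X N p + support X N p / 2| := by
  have key : ∀ R : ℝ, ‖X p + R • N p‖ = |R| ↔ quadDist X p + 2 * R * support X N p = 0 := by
    intro R
    rw [← sq_eq_sq₀ (norm_nonneg _) (abs_nonneg _), norm_add_sq_real, sq_abs, norm_smul, hN,
      inner_smul_right, mul_one, Real.norm_eq_abs, sq_abs, quadDist, support,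
      real_inner_self_eq_norm_sq]
    constructor <;> intro h <;> linarith
  rw [key, SSAt]
  constructor
  · intro h
    field_simp
    linarith
  · intro h
    field_simp at h
    linarith

/-- Among the two unit normals `±N p`, the one with positive inner product with `X p`
(meaningful when `ψ p ≠ 0`). -/
def posNormal (X N : S → E3) (p : S) : E3 := Real.sign (support X N p) • N p

/-- `φ` is a smooth local parametrization of the surface: a diffeomorphism from an open set
`φ.source` of `ℂ` onto an open set `φ.target` of `S`. -/
def IsSmoothParam (φ : OpenPartialHomeomorph ℂ S) : Prop :=
  ContMDiffOn 𝓘(ℝ, ℂ) 𝓘(ℝ, ℂ) ∞ φ φ.source ∧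
  ContMDiffOn 𝓘(ℝ, ℂ) 𝓘(ℝ, ℂ) ∞ φ.symm φ.target

end Surface

/-! ### The explicit formula -/

/-- `T = 1 + |g|²`. -/
def T (g : ℂ → ℂ) (z : ℂ) : ℝ := 1 + ‖g z‖ ^ 2

/-- `N = (2g, 2 - T) / T`. -/
def gaussFormula (g : ℂ → ℂ) (z : ℂ) : E3 := (T g z)⁻¹ • pt (2 * g z) (2 - T g z)

/-- `h = e^{⟨1, f⟩} = e^{Re f}`. -/
def hFun (f : ℂ → ℂ) (z : ℂ) : ℝ := Real.exp (f z).re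

/-- `X = e^{⟨1,f⟩} / (2|g'|²) (T g' conj f' - 2 g ⟨g', g f'⟩, -2 ⟨g', g f'⟩) + e^{⟨1,f⟩} N`. -/
def repFormula (f g : ℂ → ℂ) (z : ℂ) : E3 :=
  (hFun f z / (2 * ‖deriv g z‖ ^ 2)) •
      pt ((T g z : ℂ) * deriv g z * conj (deriv f z)
            - 2 * g z * ((inner ℝ (deriv g z) (g z * deriv f z) : ℝ) : ℂ))
        (-2 * inner ℝ (deriv g z) (g z * deriv f z))
    + hFun f z • gaussFormula g z

/-- `ξ = f' (g''/g' - (2/T) g' conj g) - f''`. -/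
def xi (f g : ℂ → ℂ) (z : ℂ) : ℂ :=
  deriv f z * (deriv (deriv g) z / deriv g z - 2 / (T g z : ℂ) * deriv g z * conj (g z))
    - deriv (deriv f) z

/-- `f, g` are holomorphic on `U` and `g'` has no zero there. -/
structure IsWeierstrassData (f g : ℂ → ℂ) (U : Set ℂ) : Prop where
  hol_f : DifferentiableOn ℂ f U
  hol_g : DifferentiableOn ℂ g U
  deriv_ne : ∀ z ∈ U, deriv g z ≠ 0

/-- On the open set `φ.target`, the surface `X` is parametrized, through `φ`, by the explicit
formula with data `f, g`. -/
structure IsRepresentation {S : Type*} [TopologicalSpace S] [ChartedSpace ℂ S] (X : S → E3)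
    (φ : OpenPartialHomeomorph ℂ S) (f g : ℂ → ℂ) : Prop where
  param : IsSmoothParam φ
  data : IsWeierstrassData f g φ.source
  eq : ∀ z ∈ φ.source, X (φ z) = repFormula f g z

/-! ### The matrix `V` -/

/-- The metric `L_{ij} = ⟨N_{,i}, N_{,j}⟩`. -/
def metricL (N : ℂ → E3) (i j : Fin 2) (z : ℂ) : ℝ := inner ℝ (pd i N z) (pd j N z)

/-- The Christoffel symbol `Γ_{ij}^m` of a metric `L` with `L_{12} = L_{21} = 0`. -/
def christoffel (L : Fin 2 → Fin 2 → ℂ → ℝ) (i j m : Fin 2) (z : ℂ) : ℝ :=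
  (pd i (L j m) z + pd j (L i m) z - pd m (L i j) z) / (2 * L m m z)

/-- `V_{ij} = (h_{,ij} - ∑ k, h_{,k} Γ_{ij}^k + h L_{ij} δ_{ij}) / L_{jj}`. -/
def matV (h : ℂ → ℝ) (N : ℂ → E3) (z : ℂ) : Matrix (Fin 2) (Fin 2) ℝ :=
  Matrix.of fun i j =>
    (pd j (pd i h) z - ∑ k, pd k h z * christoffel (metricL N) i j k z
      + h z * metricL N i j z * (if i = j then 1 else 0)) / metricL N j j z

end

end SSSurface

/-!
Everything is read off in parameters in which the Gauss map `n` is conformal. There the frame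
`n, n_{,1}, n_{,2}` of space is orthogonal with `|n_{,1}|² = |n_{,2}|² = L₁₁`, and a surface `Y` with
normal `n` is determined by its support function `h = ⟨Y, n⟩`, since `⟨Y, n_{,i}⟩ = h_{,i}`.
Differentiating once more, `⟨Y_{,j}, n_{,i}⟩ = h_{,ij} - ⟨Y, n_{,ij}⟩`, and Koszul's formula for
`n_{,ij}` turns the right hand side into `L₁₁ V_{ij}` (`IsConformalNormal.inner_pd_pd`). So `V` is the
matrix of `dY` with respect to `n_{,1}, n_{,2}`: the fundamental forms are `L₁₁ Vᵀ V` and `L₁₁ Vᵀ`,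
the Weingarten matrix is `V⁻¹`, and `Y` is immersed exactly where `det V ≠ 0`. The trace of `V`
is the Laplacian of `h` up to a term `2h`, whence `h Δh - |∇h|²` is a nonzero multiple of
`2ψH + (Λ + ψ²)K` (`IsConformalNormal.ssAt_iff`); where `h ≠ 0` its vanishing means that `log |h|`
is harmonic (`harmonicOnNhd_log_abs_iff`).

The formula `X_{f,g}` is the surface with normal `N_g` and support function `e^{Re f}`
(`repFormula_eq`, `IsWeierstrassData.isConformalNormal`). Its fundamental forms come from the
logarithmic derivative of `L₁₁ = 4|g'|²/T²`, and its support function visibly has harmonic logarithm.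

Conversely, as `K ≠ 0`, the Gauss map followed by stereographic projection is a local coordinate
wherever the normal is not the south pole (`exists_param_of_gaussMap`); in it the normal is `N_g` with
`g(z) = z`. On a disc where `ψ > 0` the harmonic function `log ψ` is the real part of a holomorphic
`f`, and the surface is `X_{f,g}` because both have the same normal and the same support function
(`exists_isRepresentation`). For the other implication, the points covered by local representations
are dense: if `ψ` vanished on an open set, the surface would be constant there. The relation is
closed, hence holds everywhere (`isSS_of_ssAt`).
-/

namespace SSSurface

open Filter Topology

/-! ### Partial derivatives -/

section Calculus

variable {F : Type*} [NormedAddCommGroup F] [NormedSpace ℝ F] {U : Set ℂ} {z : ℂ}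

theorem contDiffOn_pd {u : ℂ → F} (hU : IsOpen U) (hu : ContDiffOn ℝ ∞ u U) (i : Fin 2) :
    ContDiffOn ℝ ∞ (pd i u) U :=
  (hu.fderiv_of_isOpen hU (m := ∞) le_rfl).clm_apply contDiffOn_const

theorem differentiableAt_of_contDiffOn {u : ℂ → F} (hU : IsOpen U) (hu : ContDiffOn ℝ ∞ u U)
    (hz : z ∈ U) : DifferentiableAt ℝ u z :=
  (hu.contDiffAt (hU.mem_nhds hz)).differentiableAt (by simp)

theorem pd_congr_of_eqOn {u v : ℂ → F} (hU : IsOpen U) (h : Set.EqOn u v U) (i : Fin 2) :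
    Set.EqOn (pd i u) (pd i v) U := fun z hz => by
  have : u =ᶠ[𝓝 z] v := h.eventuallyEq_of_mem (hU.mem_nhds hz)
  simp only [pd, this.fderiv_eq]

theorem fderiv_eq_sum_pd (u : ℂ → F) (z v : ℂ) :
    fderiv ℝ u z v = v.re • pd 0 u z + v.im • pd 1 u z := by
  have : v = v.re • dir 0 + v.im • dir 1 := by
    apply Complex.ext <;> simp [dir]
  conv_lhs => rw [this]
  simp only [map_add, map_smul, pd]

theorem pd_inner {u v : ℂ → E3} (hu : DifferentiableAt ℝ u z) (hv : DifferentiableAt ℝ v z)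
    (i : Fin 2) :
    pd i (fun w => inner ℝ (u w) (v w)) z = inner ℝ (pd i u z) (v z) + inner ℝ (u z) (pd i v z) := by
  simp only [pd, fderiv_inner_apply ℝ hu hv]
  ring

theorem pd_pd_eq {u : ℂ → F} (hU : IsOpen U) (hu : ContDiffOn ℝ ∞ u U) (hz : z ∈ U) (i j : Fin 2) :
    pd i (pd j u) z = fderiv ℝ (fderiv ℝ u) z (dir i) (dir j) := by
  have hd : DifferentiableAt ℝ (fderiv ℝ u) z :=
    ((hu.contDiffAt (hU.mem_nhds hz)).fderiv_right (m := 1) (by norm_cast)).differentiableAt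
      (by simp)
  have := fderiv_clm_apply hd (differentiableAt_const (dir j) : DifferentiableAt ℝ _ z)
  change fderiv ℝ (fun y => fderiv ℝ u y (dir j)) z (dir i) = _
  rw [this]
  simp

theorem pd_comm {u : ℂ → F} (hU : IsOpen U) (hu : ContDiffOn ℝ ∞ u U) (hz : z ∈ U) (i j : Fin 2) :
    pd i (pd j u) z = pd j (pd i u) z := by
  rw [pd_pd_eq hU hu hz, pd_pd_eq hU hu hz]
  exact ((hu.contDiffAt (hU.mem_nhds hz)).isSymmSndFDerivAt
    (by simpa using (by norm_cast : (2 : ℕ∞ω) ≤ ∞))) _ _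

theorem laplacian_eq_pd {u : ℂ → F} (hU : IsOpen U) (hu : ContDiffOn ℝ ∞ u U) (hz : z ∈ U) :
    Laplacian.laplacian u z = pd 0 (pd 0 u) z + pd 1 (pd 1 u) z := by
  rw [InnerProductSpace.laplacian_eq_iteratedFDeriv_complexPlane, pd_pd_eq hU hu hz,
    pd_pd_eq hU hu hz]
  simp [iteratedFDeriv_two_apply, dir]

end Calculus

/-! ### Conformal maps into the unit sphere -/

/-- Parseval's identity for the frame formed by a unit vector and two orthogonal vectors of the same
length, both orthogonal to it. -/
theorem inner_eq_of_frame {n e₀ e₁ : E3} {l : ℝ} (hl : 0 < l) (hn : ‖n‖ = 1)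
    (h0 : inner ℝ e₀ n = 0) (h1 : inner ℝ e₁ n = 0) (h01 : inner ℝ e₀ e₁ = 0)
    (h00 : inner ℝ e₀ e₀ = l) (h11 : inner ℝ e₁ e₁ = l) (v w : E3) :
    inner ℝ v w = inner ℝ v n * inner ℝ w n
      + (inner ℝ v e₀ * inner ℝ w e₀ + inner ℝ v e₁ * inner ℝ w e₁) / l := by
  have hs : Real.sqrt l ≠ 0 := (Real.sqrt_pos.2 hl).ne'
  have hss : Real.sqrt l ^ 2 = l := Real.sq_sqrt hl.le
  -- After normalization the three vectors form an orthonormal basis.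
  let b : Fin 3 → E3 := ![n, (Real.sqrt l)⁻¹ • e₀, (Real.sqrt l)⁻¹ • e₁]
  have hb : Orthonormal ℝ b := by
    rw [orthonormal_iff_ite]
    have hnn : inner ℝ n n = 1 := by rw [real_inner_self_eq_norm_sq, hn]; norm_num
    have h0' : inner ℝ n e₀ = 0 := by rw [real_inner_comm, h0]
    have h1' : inner ℝ n e₁ = 0 := by rw [real_inner_comm, h1]
    have h01' : inner ℝ e₁ e₀ = 0 := by rw [real_inner_comm, h01]
    intro i j
    fin_cases i <;> fin_cases j <;>
      simp only [b, Fin.zero_eta, Fin.mk_one, Fin.reduceFinMk, Matrix.cons_val, inner_smul_left,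
        inner_smul_right, hnn, h0, h1, h01, h00, h11, h0', h1', h01'] <;> simp
    all_goals field_simp
    all_goals exact hss.symm
  let B : OrthonormalBasis (Fin 3) ℝ E3 := (basisOfOrthonormalOfCardEqFinrank hb
    (by simp)).toOrthonormalBasis (by simpa using hb)
  have hB : ∀ i, B i = b i := fun i => by simp [B]
  rw [← B.sum_inner_mul_inner v w, Fin.sum_univ_three]
  simp only [hB, b, Matrix.cons_val, inner_smul_right, real_inner_comm w]
  rw [← hss]
  simp
  field_simp
  ring

/-- A smooth conformal immersion `n` of the open set `U` into the unit sphere. -/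
structure IsConformalSphereMap (n : ℂ → E3) (U : Set ℂ) : Prop where
  isOpen : IsOpen U
  smooth : ContDiffOn ℝ ∞ n U
  unit : ∀ z ∈ U, ‖n z‖ = 1
  diag : ∀ z ∈ U, metricL n 0 0 z = metricL n 1 1 z
  off_diag : ∀ z ∈ U, metricL n 0 1 z = 0
  ne_zero : ∀ z ∈ U, metricL n 0 0 z ≠ 0

namespace IsConformalSphereMap

variable {n : ℂ → E3} {U : Set ℂ} {z : ℂ}

theorem pos (hn : IsConformalSphereMap n U) (hz : z ∈ U) : 0 < metricL n 0 0 z :=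
  lt_of_le_of_ne (by simp only [metricL]; exact real_inner_self_nonneg) (hn.ne_zero z hz).symm

theorem metricL_comm (n : ℂ → E3) (i j : Fin 2) (z : ℂ) : metricL n i j z = metricL n j i z :=
  real_inner_comm _ _

theorem metricL_eq (hn : IsConformalSphereMap n U) (hz : z ∈ U) (i j : Fin 2) :
    metricL n i j z = if i = j then metricL n 0 0 z else 0 := by
  have h1 := hn.diag z hz
  have h2 := hn.off_diag z hz
  have h3 := metricL_comm n 1 0 z
  fin_cases i <;> fin_cases j <;> simp [h1, h2, h3]

theorem differentiableAt (hn : IsConformalSphereMap n U) (hz : z ∈ U) : DifferentiableAt ℝ n z :=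
  differentiableAt_of_contDiffOn hn.isOpen hn.smooth hz

theorem differentiableAt_pd (hn : IsConformalSphereMap n U) (hz : z ∈ U) (i : Fin 2) :
    DifferentiableAt ℝ (pd i n) z :=
  differentiableAt_of_contDiffOn hn.isOpen (contDiffOn_pd hn.isOpen hn.smooth i) hz

theorem inner_pd_self (hn : IsConformalSphereMap n U) (hz : z ∈ U) (i : Fin 2) :
    inner ℝ (pd i n z) (n z) = 0 := by
  have h1 : Set.EqOn (fun w => (inner ℝ (n w) (n w) : ℝ)) (fun _ => 1) U := fun w hw => by
    simp [hn.unit w hw]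
  have h2 := pd_congr_of_eqOn hn.isOpen h1 i hz
  rw [pd_inner (hn.differentiableAt hz) (hn.differentiableAt hz), real_inner_comm (pd i n z)] at h2
  simp only [pd, fderiv_fun_const, Pi.zero_apply, zero_apply] at h2 ⊢
  rw [real_inner_comm] at h2 ⊢
  linarith

theorem inner_eq (hn : IsConformalSphereMap n U) (hz : z ∈ U) (v w : E3) :
    inner ℝ v w = inner ℝ v (n z) * inner ℝ w (n z)
      + (inner ℝ v (pd 0 n z) * inner ℝ w (pd 0 n z)
          + inner ℝ v (pd 1 n z) * inner ℝ w (pd 1 n z)) / metricL n 0 0 z :=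
  inner_eq_of_frame (hn.pos hz) (hn.unit z hz) (hn.inner_pd_self hz 0) (hn.inner_pd_self hz 1)
    (hn.off_diag z hz) rfl (hn.diag z hz).symm v w

/-- A vector is determined by its inner products with `n, n_{,1}, n_{,2}`. -/
theorem ext_frame (hn : IsConformalSphereMap n U) (hz : z ∈ U) {v w : E3}
    (h : inner ℝ v (n z) = inner ℝ w (n z))
    (h' : ∀ i, inner ℝ v (pd i n z) = inner ℝ w (pd i n z)) : v = w :=
  ext_inner_right ℝ fun u => by rw [hn.inner_eq hz v u, hn.inner_eq hz w u, h, h' 0, h' 1]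

theorem inner_pd_pd_self (hn : IsConformalSphereMap n U) (hz : z ∈ U) (i j : Fin 2) :
    inner ℝ (pd j (pd i n) z) (n z) = - metricL n i j z := by
  have h1 : Set.EqOn (fun w => (inner ℝ (pd i n w) (n w) : ℝ)) (fun _ => 0) U :=
    fun w hw => hn.inner_pd_self hw i
  have h2 := pd_congr_of_eqOn hn.isOpen h1 j hz
  rw [pd_inner (hn.differentiableAt_pd hz i) (hn.differentiableAt hz)] at h2
  simp only [pd, metricL, fderiv_fun_const, Pi.zero_apply, zero_apply] at h2 ⊢
  linarith

/-- Koszul's formula for the tangential part of the second derivatives of `n`. -/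
theorem inner_pd_pd_pd (hn : IsConformalSphereMap n U) (hz : z ∈ U) (i j k : Fin 2) :
    inner ℝ (pd j (pd i n) z) (pd k n z)
      = metricL n 0 0 z * christoffel (metricL n) i j k z := by
  have hL : ∀ a b c : Fin 2, pd c (metricL n a b) z
      = inner ℝ (pd c (pd a n) z) (pd b n z) + inner ℝ (pd a n z) (pd c (pd b n) z) := fun a b c =>
    pd_inner (hn.differentiableAt_pd hz a) (hn.differentiableAt_pd hz b) c
  have hk : metricL n k k z = metricL n 0 0 z := by rw [hn.metricL_eq hz, if_pos rfl]
  have h0 := hn.ne_zero z hz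
  rw [christoffel, hk, hL, hL, hL, pd_comm hn.isOpen hn.smooth hz i j,
    pd_comm hn.isOpen hn.smooth hz k j, pd_comm hn.isOpen hn.smooth hz k i]
  simp only [real_inner_comm (pd k n z), real_inner_comm (pd j n z)]
  field_simp
  ring

/-- The Christoffel symbols of a conformal metric. -/
theorem christoffel_eq (hn : IsConformalSphereMap n U) (hz : z ∈ U) {p q : ℝ}
    (hp : pd 0 (metricL n 0 0) z = 2 * metricL n 0 0 z * p)
    (hq : pd 1 (metricL n 0 0) z = 2 * metricL n 0 0 z * q) :
    christoffel (metricL n) 0 0 0 z = p ∧ christoffel (metricL n) 0 0 1 z = -q ∧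
    christoffel (metricL n) 0 1 0 z = q ∧ christoffel (metricL n) 0 1 1 z = p ∧
    christoffel (metricL n) 1 1 0 z = -p ∧ christoffel (metricL n) 1 1 1 z = q := by
  have h11 : ∀ c, pd c (metricL n 1 1) z = pd c (metricL n 0 0) z := fun c =>
    (pd_congr_of_eqOn hn.isOpen (fun w hw => (hn.diag w hw)) c hz).symm
  have h01 : ∀ c, pd c (metricL n 0 1) z = 0 := fun c => by
    rw [pd_congr_of_eqOn hn.isOpen (v := fun _ => 0) (fun w hw => (hn.off_diag w hw)) c hz]
    simp [pd]
  have h10 : ∀ c, pd c (metricL n 1 0) z = 0 := fun c => by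
    rw [← h01 c]
    congr 1
    funext w
    exact metricL_comm n 1 0 w
  have h0 := hn.ne_zero z hz
  have hd := hn.diag z hz
  refine ⟨?_, ?_, ?_, ?_, ?_, ?_⟩ <;>
    simp only [christoffel, h11, h01, h10, hp, hq, ← hd] <;> field_simp <;> ring

end IsConformalSphereMap

/-! ### Surfaces whose Gauss map is conformal in the parameters -/

/-- The map `Y` on `U` has the conformal sphere map `n` as unit normal. -/
structure IsConformalNormal (Y n : ℂ → E3) (U : Set ℂ) : Prop extends
    IsConformalSphereMap n U where
  smooth_surface : ContDiffOn ℝ ∞ Y U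
  normal : ∀ z ∈ U, ∀ i, inner ℝ (pd i Y z) (n z) = 0

namespace IsConformalNormal

variable {Y n : ℂ → E3} {U : Set ℂ} {z : ℂ}

theorem smooth_support (hY : IsConformalNormal Y n U) : ContDiffOn ℝ ∞ (support Y n) U :=
  hY.smooth_surface.inner ℝ hY.smooth

theorem differentiableAt_surface (hY : IsConformalNormal Y n U) (hz : z ∈ U) :
    DifferentiableAt ℝ Y z :=
  differentiableAt_of_contDiffOn hY.isOpen hY.smooth_surface hz

/-- `⟨Y_{,i}, n⟩ = 0`, so only the normal gets differentiated. -/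
theorem pd_support (hY : IsConformalNormal Y n U) (hz : z ∈ U) (i : Fin 2) :
    pd i (support Y n) z = inner ℝ (Y z) (pd i n z) := by
  have := pd_inner (hY.differentiableAt_surface hz) (hY.differentiableAt hz) i
  rw [hY.normal z hz, zero_add] at this
  exact this

/-- `⟨Y_{,j}, n_{,i}⟩ = h_{,ij} - ⟨Y, n_{,ij}⟩`, and `n_{,ij}` is known in the frame
`n, n_{,1}, n_{,2}`. -/
theorem inner_pd_pd (hY : IsConformalNormal Y n U) (hz : z ∈ U) (i j : Fin 2) :
    inner ℝ (pd j Y z) (pd i n z) = metricL n 0 0 z * matV (support Y n) n z i j := by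
  have h1 : pd j (pd i (support Y n)) z
      = inner ℝ (pd j Y z) (pd i n z) + inner ℝ (Y z) (pd j (pd i n) z) := by
    rw [pd_congr_of_eqOn hY.isOpen (fun w hw => hY.pd_support hw i) j hz,
      pd_inner (hY.differentiableAt_surface hz) (hY.differentiableAt_pd hz i)]
  have h2 : inner ℝ (Y z) (pd j (pd i n) z) = - support Y n z * metricL n i j z
      + ∑ k, pd k (support Y n) z * christoffel (metricL n) i j k z := by
    rw [hY.inner_eq hz, hY.inner_pd_pd_self hz, hY.inner_pd_pd_pd hz, hY.inner_pd_pd_pd hz,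
      Fin.sum_univ_two, hY.pd_support hz, hY.pd_support hz, support]
    have := hY.ne_zero z hz
    field_simp
  have hjj : metricL n j j z = metricL n 0 0 z := by rw [hY.metricL_eq hz, if_pos rfl]
  have hδ : metricL n i j z * (if i = j then 1 else 0) = metricL n i j z := by
    rw [hY.metricL_eq hz]; split_ifs <;> simp
  rw [matV, Matrix.of_apply, hjj, mul_div_cancel₀ _ (hY.ne_zero z hz), mul_assoc, hδ]
  linarith

theorem matV_symm (hY : IsConformalNormal Y n U) (hz : z ∈ U) :
    matV (support Y n) n z 1 0 = matV (support Y n) n z 0 1 := by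
  have h := pd_comm hY.isOpen hY.smooth_support hz 0 1
  have hc : ∀ k, christoffel (metricL n) 1 0 k z = christoffel (metricL n) 0 1 k z := fun k => by
    have : metricL n 1 0 = metricL n 0 1 := funext fun w =>
      IsConformalSphereMap.metricL_comm n 1 0 w
    simp only [christoffel, this]
    ring
  have hd := hY.diag z hz
  have h01 := hY.off_diag z hz
  have h10 : metricL n 1 0 z = 0 := by rw [IsConformalSphereMap.metricL_comm, h01]
  simp only [matV, Matrix.of_apply, Fin.sum_univ_two, hc, h01, h10, hd, h, mul_zero, zero_mul]

theorem secondForm_eq (hY : IsConformalNormal Y n U) (hz : z ∈ U) :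
    secondForm Y n z = metricL n 0 0 z • (matV (support Y n) n z).transpose := by
  ext i j
  rw [secondForm, Matrix.of_apply, coordDeriv_eq_pd, coordDeriv_eq_pd, hY.inner_pd_pd hz,
    Matrix.smul_apply, Matrix.transpose_apply, smul_eq_mul]

theorem firstForm_eq (hY : IsConformalNormal Y n U) (hz : z ∈ U) :
    firstForm Y z = metricL n 0 0 z •
      ((matV (support Y n) n z).transpose * matV (support Y n) n z) := by
  have h0 := hY.ne_zero z hz
  ext i j
  rw [firstForm, Matrix.of_apply, coordDeriv_eq_pd, coordDeriv_eq_pd, hY.inner_eq hz,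
    hY.normal z hz, hY.normal z hz]
  simp only [hY.inner_pd_pd hz, Matrix.smul_apply, Matrix.mul_apply, Fin.sum_univ_two,
    Matrix.transpose_apply, smul_eq_mul]
  field_simp
  ring

theorem transpose_matV (hY : IsConformalNormal Y n U) (hz : z ∈ U) :
    (matV (support Y n) n z).transpose = matV (support Y n) n z := by
  have := hY.matV_symm hz
  ext i j
  fin_cases i <;> fin_cases j <;> simp [this]

/-- The Weingarten matrix is the inverse of `V`. -/
theorem weingarten_eq_inv (hY : IsConformalNormal Y n U) (hz : z ∈ U)
    (hV : (matV (support Y n) n z).det ≠ 0) :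
    weingarten Y n z = (matV (support Y n) n z)⁻¹ := by
  have h0 := hY.ne_zero z hz
  have hu : IsUnit (matV (support Y n) n z).det := hV.isUnit
  rw [weingarten, hY.secondForm_eq hz, hY.firstForm_eq hz, hY.transpose_matV hz]
  set V := matV (support Y n) n z
  have hinv : (metricL n 0 0 z • (V * V))⁻¹ = (metricL n 0 0 z)⁻¹ • (V⁻¹ * V⁻¹) := by
    apply Matrix.inv_eq_right_inv
    rw [Matrix.smul_mul, Matrix.mul_smul, smul_smul, mul_inv_cancel₀ h0, one_smul,
      Matrix.mul_assoc, Matrix.mul_nonsing_inv_cancel_left _ _ hu, Matrix.mul_nonsing_inv _ hu]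
  rw [hinv, Matrix.transpose_smul, hY.transpose_matV hz, Matrix.smul_mul, Matrix.mul_smul,
    smul_smul, mul_inv_cancel₀ h0, one_smul,
    Matrix.mul_nonsing_inv_cancel_left _ _ hu]

theorem gaussCurvature_eq (hY : IsConformalNormal Y n U) (hz : z ∈ U)
    (hV : (matV (support Y n) n z).det ≠ 0) :
    gaussCurvature Y n z = 1 / (matV (support Y n) n z).det := by
  rw [gaussCurvature, hY.weingarten_eq_inv hz hV, Matrix.det_nonsing_inv, Ring.inverse_eq_inv',
    one_div]

theorem meanCurvature_eq (hY : IsConformalNormal Y n U) (hz : z ∈ U)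
    (hV : (matV (support Y n) n z).det ≠ 0) :
    meanCurvature Y n z
      = -((matV (support Y n) n z).trace / (matV (support Y n) n z).det) / 2 := by
  rw [meanCurvature, hY.weingarten_eq_inv hz hV, Matrix.inv_def, Ring.inverse_eq_inv',
    Matrix.trace_smul, Matrix.adjugate_fin_two, Matrix.trace_fin_two, Matrix.trace_fin_two]
  simp only [Matrix.of_apply, Matrix.cons_val', Matrix.cons_val, smul_eq_mul]
  rw [inv_mul_eq_div, add_comm]

/-- `V` is the matrix of the differential of `Y` with respect to the basis `n_{,1}, n_{,2}` of the
tangent plane. -/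
theorem pd_eq_sum (hY : IsConformalNormal Y n U) (hz : z ∈ U) (j : Fin 2) :
    pd j Y z = ∑ i, matV (support Y n) n z i j • pd i n z := by
  have h01 : inner ℝ (pd 0 n z) (pd 1 n z) = (0 : ℝ) := hY.off_diag z hz
  have h10 : inner ℝ (pd 1 n z) (pd 0 n z) = (0 : ℝ) := by rw [real_inner_comm, h01]
  have h11 : inner ℝ (pd 1 n z) (pd 1 n z) = metricL n 0 0 z := (hY.diag z hz).symm
  have h00 : inner ℝ (pd 0 n z) (pd 0 n z) = metricL n 0 0 z := rfl
  refine hY.ext_frame hz ?_ fun k => ?_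
  · simp [hY.normal z hz, inner_add_left, inner_smul_left, hY.inner_pd_self hz]
  · rw [hY.inner_pd_pd hz, Fin.sum_univ_two]
    fin_cases k <;>
      simp only [Fin.zero_eta, Fin.mk_one, inner_add_left, real_inner_smul_left, h01, h10, h00,
        h11] <;> ring

theorem injective_iff (hY : IsConformalNormal Y n U) (hz : z ∈ U) :
    Function.Injective (fderiv ℝ Y z) ↔ (matV (support Y n) n z).det ≠ 0 := by
  have h0 := hY.ne_zero z hz
  -- Both kernels are compared: `dY(v) = 0` if and only if `V` kills the coordinates of `v`.
  rw [← not_iff_not, not_not, ← Matrix.exists_mulVec_eq_zero_iff, injective_iff_map_eq_zero]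
  have key : ∀ v : ℂ, fderiv ℝ Y z v = 0 ↔
      (matV (support Y n) n z).mulVec ![v.re, v.im] = 0 := by
    intro v
    have hi : ∀ i, inner ℝ (fderiv ℝ Y z v) (pd i n z)
        = metricL n 0 0 z * (matV (support Y n) n z).mulVec ![v.re, v.im] i := by
      intro i
      rw [fderiv_eq_sum_pd, inner_add_left, inner_smul_left, inner_smul_left,
        hY.inner_pd_pd hz, hY.inner_pd_pd hz]
      simp [Matrix.mulVec, dotProduct, Fin.sum_univ_two]
      ring
    constructor
    · intro h
      ext i
      have := hi i
      rw [h, inner_zero_left] at this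
      simpa [h0] using this.symm
    · intro h
      refine hY.ext_frame hz ?_ fun i => ?_
      · rw [fderiv_eq_sum_pd, inner_add_left, inner_smul_left, inner_smul_left, hY.normal z hz,
          hY.normal z hz]
        simp
      · rw [hi, h]
        simp
  simp only [key]
  push Not
  constructor
  · rintro ⟨v, hv, hv0⟩
    refine ⟨_, fun h => hv0 ?_, hv⟩
    apply Complex.ext
    · simpa using congrFun h 0
    · simpa using congrFun h 1
  · rintro ⟨v, hv0, hv⟩
    refine ⟨⟨v 0, v 1⟩, ?_, fun h => hv0 ?_⟩
    · convert hv
      ext i; fin_cases i <;> rfl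
    · ext i; fin_cases i
      · simpa using congrArg Complex.re h
      · simpa using congrArg Complex.im h

/-- In parameters that are conformal for the third fundamental form `L`, the expression
`h Δh - |∇h|²` of the support function equals `-L_{11} / K` times the left hand side of the
relation `2ψH + (Λ + ψ²)K = 0`. -/
theorem ssAt_iff (hY : IsConformalNormal Y n U) (hz : z ∈ U)
    (hV : (matV (support Y n) n z).det ≠ 0) :
    SSAt Y n z ↔ support Y n z * Laplacian.laplacian (support Y n) z
      - (pd 0 (support Y n) z ^ 2 + pd 1 (support Y n) z ^ 2) = 0 := by
  have h0 := hY.ne_zero z hz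
  have hΛ : quadDist Y z = support Y n z ^ 2
      + (pd 0 (support Y n) z ^ 2 + pd 1 (support Y n) z ^ 2) / metricL n 0 0 z := by
    rw [quadDist, hY.inner_eq hz, hY.pd_support hz, hY.pd_support hz, support]
    ring
  have htr : metricL n 0 0 z * (matV (support Y n) n z).trace
      = Laplacian.laplacian (support Y n) z + 2 * support Y n z * metricL n 0 0 z := by
    rw [laplacian_eq_pd hY.isOpen hY.smooth_support hz, Matrix.trace_fin_two]
    simp only [matV, Matrix.of_apply, Fin.sum_univ_two, ← hY.diag z hz, if_true]
    field_simp
    obtain ⟨c1, c2, -, -, c5, c6⟩ := hY.christoffel_eq hz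
      (p := pd 0 (metricL n 0 0) z / (2 * metricL n 0 0 z))
      (q := pd 1 (metricL n 0 0) z / (2 * metricL n 0 0 z)) (by field_simp) (by field_simp)
    rw [c1, c2, c5, c6]
    ring
  rw [SSAt, hY.gaussCurvature_eq hz hV, hY.meanCurvature_eq hz hV, hΛ]
  have hlap : Laplacian.laplacian (support Y n) z = metricL n 0 0 z *
    (matV (support Y n) n z).trace - 2 * support Y n z * metricL n 0 0 z := by linarith
  rw [hlap]
  field_simp
  constructor <;> intro h <;> linarith

/-- If the support function vanishes on an open set, then so do its derivatives `⟨Y, n_{,i}⟩`, and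
all components of `Y` in the frame `n, n_{,1}, n_{,2}` are zero. -/
theorem eq_zero_of_support_eq_zero (hY : IsConformalNormal Y n U)
    (h : ∀ w ∈ U, support Y n w = 0) (hz : z ∈ U) : Y z = 0 := by
  refine hY.ext_frame hz (by simpa [support] using h z hz) fun i => ?_
  rw [← hY.pd_support hz, inner_zero_left,
    pd_congr_of_eqOn hY.isOpen (v := fun _ => 0) (fun w hw => h w hw) i hz]
  simp [pd]

end IsConformalNormal

/-! ### Stereographic projection -/

theorem inner_pt (a b : ℂ) (s t : ℝ) :
    inner ℝ (pt a s) (pt b t) = a.re * b.re + a.im * b.im + s * t := by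
  simp [pt, PiLp.inner_apply, Fin.sum_univ_three]
  ring

theorem contDiffOn_pt {U : Set ℂ} {w : ℂ → ℂ} {t : ℂ → ℝ} (hw : ContDiffOn ℝ ∞ w U)
    (ht : ContDiffOn ℝ ∞ t U) : ContDiffOn ℝ ∞ (fun z => pt (w z) (t z)) U := by
  rw [contDiffOn_euclidean]
  intro i
  fin_cases i
  · exact Complex.reCLM.contDiff.comp_contDiffOn hw
  · exact Complex.imCLM.contDiff.comp_contDiffOn hw
  · exact ht

theorem T_pos (g : ℂ → ℂ) (z : ℂ) : 0 < T g z := by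
  unfold T; positivity

theorem T_eq (g : ℂ → ℂ) (z : ℂ) : T g z = 1 + ((g z).re ^ 2 + (g z).im ^ 2) := by
  rw [T, ← Complex.normSq_eq_norm_sq, Complex.normSq_apply]; ring

/-- The parametrization `w ↦ (2w, 1 - |w|²) / (1 + |w|²)` of the sphere without the south pole,
inverse to stereographic projection. -/
noncomputable def stereo (w : ℂ) : E3 := gaussFormula id w

/-- The differential at `w` of `stereo`, applied to `v`. -/
noncomputable def stereoDeriv (w v : ℂ) : E3 :=
  ((T id w) ^ 2)⁻¹ • pt (2 * (T id w : ℂ) * v - 4 * (inner ℝ w v : ℝ) * w) (-4 * inner ℝ w v)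

theorem gaussFormula_eq (g : ℂ → ℂ) (z : ℂ) : gaussFormula g z = stereo (g z) := rfl

theorem contDiff_stereo : ContDiff ℝ ∞ stereo := by
  rw [← contDiffOn_univ]
  have hT : ContDiffOn ℝ ∞ (T id) Set.univ :=
    contDiffOn_const.add (contDiff_norm_sq ℝ).contDiffOn
  exact (hT.inv fun z _ => (T_pos id z).ne').smul
    (contDiffOn_pt (contDiffOn_const.mul contDiffOn_id) (contDiffOn_const.sub hT))

theorem norm_stereo (w : ℂ) : ‖stereo w‖ = 1 := by
  have hT := (T_pos id w).ne'
  have h : inner ℝ (stereo w) (stereo w) = (1 : ℝ) := by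
    rw [stereo, gaussFormula, inner_smul_left, inner_smul_right, inner_pt]
    simp only [Complex.mul_re, Complex.mul_im, Complex.re_ofNat, Complex.im_ofNat, conj_trivial]
    field_simp
    rw [T_eq]
    simp only [id]
    ring
  rw [real_inner_self_eq_norm_sq] at h
  nlinarith [norm_nonneg (stereo w)]

theorem hasDerivAt_pt {a : ℝ → ℂ} {s : ℝ → ℝ} {a' : ℂ} {s' t : ℝ} (ha : HasDerivAt a a' t)
    (hs : HasDerivAt s s' t) : HasDerivAt (fun x => pt (a x) (s x)) (pt a' s') t := by
  have h : ∀ c r, pt c r = c.re • pt 1 0 + c.im • pt Complex.I 0 + r • pt 0 1 := fun c r => by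
    ext i
    fin_cases i <;> simp [pt]
  simp only [fun x => h (a x) (s x), h a' s']
  have hre : HasDerivAt (fun x => (a x).re) a'.re t := Complex.reCLM.hasFDerivAt.comp_hasDerivAt t ha
  have him : HasDerivAt (fun x => (a x).im) a'.im t := Complex.imCLM.hasFDerivAt.comp_hasDerivAt t ha
  exact ((hre.smul_const _).add (him.smul_const _)).add (hs.smul_const _)

theorem hasDerivAt_stereo_line (w v : ℂ) :
    HasDerivAt (fun t : ℝ => stereo (w + t • v)) (stereoDeriv w v) 0 := by
  have hl : HasDerivAt (fun t : ℝ => w + t • v) v 0 := by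
    simpa using ((hasDerivAt_id (0 : ℝ)).smul_const v).const_add w
  have hT : HasDerivAt (fun t : ℝ => T id (w + t • v)) (2 * inner ℝ w v) 0 := by
    have := hl.norm_sq.const_add 1
    rw [zero_smul, add_zero] at this
    exact this
  have hne := (T_pos id w).ne'
  have hne' := (T_pos id (w + (0 : ℝ) • v)).ne'
  have h : HasDerivAt (fun t : ℝ => stereo (w + t • v)) _ 0 :=
    (hT.fun_inv hne').fun_smul (hasDerivAt_pt (hl.const_mul 2) (hT.const_sub 2))
  refine h.congr_deriv ?_
  rw [zero_smul, add_zero]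
  ext i
  fin_cases i <;> simp [stereoDeriv, pt] <;> field_simp <;> ring

theorem fderiv_stereo (w v : ℂ) : fderiv ℝ stereo w v = stereoDeriv w v := by
  have hd : HasFDerivAt stereo (fderiv ℝ stereo w) (w + (0 : ℝ) • v) := by
    simpa using (contDiff_stereo.differentiable (by simp) w).hasFDerivAt
  have hl : HasDerivAt (fun t : ℝ => w + t • v) v 0 := by
    simpa using ((hasDerivAt_id (0 : ℝ)).smul_const v).const_add w
  exact (hd.comp_hasDerivAt (0 : ℝ) hl).unique (hasDerivAt_stereo_line w v)

theorem inner_stereoDeriv_stereo (w v : ℂ) : inner ℝ (stereoDeriv w v) (stereo w) = 0 := by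
  have hT := (T_pos id w).ne'
  rw [stereo, gaussFormula, stereoDeriv, inner_smul_left, inner_smul_right, inner_pt]
  simp [Complex.inner]
  right
  rw [T_eq]
  simp only [id]
  ring

/-- Stereographic projection is conformal, with factor `4 / (1 + |w|²)²`. -/
theorem inner_stereoDeriv (w v v' : ℂ) :
    inner ℝ (stereoDeriv w v) (stereoDeriv w v') = 4 * inner ℝ v v' / T id w ^ 2 := by
  have hT := (T_pos id w).ne'
  rw [stereoDeriv, stereoDeriv, inner_smul_left, inner_smul_right, inner_pt]
  simp [Complex.inner]
  field_simp
  rw [T_eq]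
  simp only [id]
  ring

/-! ### The surface given by the explicit formula -/

section HolomorphicCalculus

variable {F : ℂ → ℂ} {U : Set ℂ} {z : ℂ}

theorem contDiffOn_real_of_holomorphic (hU : IsOpen U) (hF : DifferentiableOn ℂ F U) :
    ContDiffOn ℝ ∞ F U :=
  (hF.contDiffOn hU).restrict_scalars ℝ

theorem fderiv_real_apply (hF : DifferentiableAt ℂ F z) (v : ℂ) :
    fderiv ℝ F z v = deriv F z * v := by
  rw [hF.fderiv_restrictScalars ℝ]
  simp [mul_comm]

theorem pd_re (hF : DifferentiableAt ℂ F z) (i : Fin 2) :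
    pd i (fun w => (F w).re) z = (deriv F z * dir i).re := by
  have h := (Complex.reCLM.hasFDerivAt.comp z (hF.restrictScalars ℝ).hasFDerivAt).fderiv
  change fderiv ℝ (Complex.reCLM ∘ F) z (dir i) = _
  rw [h, ContinuousLinearMap.comp_apply, fderiv_real_apply hF]
  rfl

theorem pd_norm_sq (hF : DifferentiableAt ℂ F z) (i : Fin 2) :
    pd i (fun w => ‖F w‖ ^ 2) z = 2 * (conj (F z) * deriv F z * dir i).re := by
  have h := (hF.restrictScalars ℝ).hasFDerivAt.norm_sq.fderiv
  change fderiv ℝ (fun w => ‖F w‖ ^ 2) z (dir i) = _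
  rw [h]
  simp only [smul_apply, ContinuousLinearMap.comp_apply, innerSL_apply_apply,
    fderiv_real_apply hF, Complex.inner]
  simp
  ring

end HolomorphicCalculus

section ExplicitFormula

variable {f g : ℂ → ℂ} {U : Set ℂ} {z : ℂ}

theorem pd_gaussFormula (hg : DifferentiableAt ℂ g z) (i : Fin 2) :
    pd i (gaussFormula g) z = stereoDeriv (g z) (deriv g z * dir i) := by
  have h := ((contDiff_stereo.differentiable (by simp) (g z)).hasFDerivAt.comp z
    (hg.restrictScalars ℝ).hasFDerivAt).fderiv
  change fderiv ℝ (stereo ∘ g) z (dir i) = _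
  rw [h, ContinuousLinearMap.comp_apply, fderiv_real_apply hg, fderiv_stereo]

theorem inner_deriv_mul_dir (a : ℂ) :
    inner ℝ (a * dir 0) (a * dir 0) = ‖a‖ ^ 2 ∧ inner ℝ (a * dir 1) (a * dir 1) = ‖a‖ ^ 2 ∧
      inner ℝ (a * dir 0) (a * dir 1) = (0 : ℝ) := by
  refine ⟨?_, ?_, ?_⟩ <;>
    simp [dir, Complex.inner, ← Complex.normSq_eq_norm_sq, Complex.normSq_apply]
  all_goals ring

theorem metricL_gaussFormula (hg : DifferentiableAt ℂ g z) :
    metricL (gaussFormula g) 0 0 z = 4 * ‖deriv g z‖ ^ 2 / T g z ^ 2 := by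
  rw [metricL, pd_gaussFormula hg, inner_stereoDeriv, (inner_deriv_mul_dir _).1]
  rfl

theorem IsWeierstrassData.isConformalSphereMap (h : IsWeierstrassData f g U) (hU : IsOpen U) :
    IsConformalSphereMap (gaussFormula g) U where
  isOpen := hU
  smooth := contDiff_stereo.comp_contDiffOn (contDiffOn_real_of_holomorphic hU h.hol_g)
  unit z _ := norm_stereo (g z)
  diag z hz := by
    have hg := h.hol_g.differentiableAt (hU.mem_nhds hz)
    simp only [metricL, pd_gaussFormula hg, inner_stereoDeriv, (inner_deriv_mul_dir _).1,
      (inner_deriv_mul_dir _).2.1]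
  off_diag z hz := by
    have hg := h.hol_g.differentiableAt (hU.mem_nhds hz)
    simp only [metricL, pd_gaussFormula hg, inner_stereoDeriv, (inner_deriv_mul_dir _).2.2]
    simp
  ne_zero z hz := by
    rw [metricL_gaussFormula (h.hol_g.differentiableAt (hU.mem_nhds hz))]
    have := norm_ne_zero_iff.2 (h.deriv_ne z hz)
    have := (T_pos g z).ne'
    positivity

/-- The explicit formula is `h N` plus the gradient of `h` for the metric of the sphere. -/
theorem repFormula_eq (f g : ℂ → ℂ) (z : ℂ) :
    repFormula f g z = (hFun f z * T g z ^ 2 / (4 * ‖deriv g z‖ ^ 2)) •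
      stereoDeriv (g z) (deriv g z * conj (deriv f z)) + hFun f z • stereo (g z) := by
  have hT := (T_pos g z).ne'
  have hT' : T id (g z) = T g z := rfl
  rw [repFormula, gaussFormula_eq]
  congr 1
  rw [stereoDeriv, smul_smul, hT']
  have h1 : hFun f z * T g z ^ 2 / (4 * ‖deriv g z‖ ^ 2) * (T g z ^ 2)⁻¹
      = hFun f z / (2 * ‖deriv g z‖ ^ 2) * (1 / 2) := by
    field_simp
    norm_num
  rw [h1, mul_smul]
  congr 1
  ext i
  fin_cases i <;> simp [pt, Complex.inner] <;> ring

theorem inner_repFormula_gaussFormula (f g : ℂ → ℂ) (z : ℂ) :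
    inner ℝ (repFormula f g z) (gaussFormula g z) = hFun f z := by
  rw [repFormula_eq, gaussFormula_eq, inner_add_left, inner_smul_left, inner_smul_left,
    inner_stereoDeriv_stereo, real_inner_self_eq_norm_sq, norm_stereo]
  simp

theorem pd_hFun (hf : DifferentiableAt ℂ f z) (i : Fin 2) :
    pd i (hFun f) z = hFun f z * (deriv f z * dir i).re := by
  rw [← pd_re hf]
  have hd : DifferentiableAt ℝ (fun w => (f w).re) z :=
    Complex.reCLM.differentiableAt.comp z (hf.restrictScalars ℝ)
  change fderiv ℝ (fun w => Real.exp ((f w).re)) z (dir i) = _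
  rw [hd.hasFDerivAt.exp.fderiv]
  simp [hFun, pd]

/-- The tangential part of the formula is the gradient of `h`. -/
theorem inner_repFormula_pd (hf : DifferentiableAt ℂ f z) (hg : DifferentiableAt ℂ g z)
    (hg' : deriv g z ≠ 0) (i : Fin 2) :
    inner ℝ (repFormula f g z) (pd i (gaussFormula g) z) = pd i (hFun f) z := by
  have hT := (T_pos g z).ne'
  have hT' : T id (g z) = T g z := rfl
  have hn := norm_ne_zero_iff.2 hg'
  rw [repFormula_eq, pd_gaussFormula hg, inner_add_left, inner_smul_left, inner_smul_left,
    real_inner_comm _ (stereo (g z)), inner_stereoDeriv_stereo, inner_stereoDeriv, pd_hFun hf, hT']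
  have h : inner ℝ (deriv g z * conj (deriv f z)) (deriv g z * dir i)
      = ‖deriv g z‖ ^ 2 * (deriv f z * dir i).re := by
    rw [Complex.inner, ← Complex.normSq_eq_norm_sq, Complex.normSq_apply]
    simp
    ring
  rw [h]
  simp
  field_simp

theorem IsWeierstrassData.contDiffOn_hFun (h : IsWeierstrassData f g U) (hU : IsOpen U) :
    ContDiffOn ℝ ∞ (hFun f) U :=
  (Complex.reCLM.contDiff.comp_contDiffOn (contDiffOn_real_of_holomorphic hU h.hol_f)).exp

theorem IsWeierstrassData.contDiffOn_repFormula (h : IsWeierstrassData f g U) (hU : IsOpen U) :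
    ContDiffOn ℝ ∞ (repFormula f g) U := by
  have hf := contDiffOn_real_of_holomorphic hU h.hol_f
  have hg := contDiffOn_real_of_holomorphic hU h.hol_g
  have hf' := contDiffOn_real_of_holomorphic hU (h.hol_f.deriv hU)
  have hg' := contDiffOn_real_of_holomorphic hU (h.hol_g.deriv hU)
  have hh := h.contDiffOn_hFun hU
  have hT : ContDiffOn ℝ ∞ (T g) U := contDiffOn_const.add (hg.norm_sq ℝ)
  have hTc : ContDiffOn ℝ ∞ (fun z => (T g z : ℂ)) U :=
    Complex.ofRealCLM.contDiff.comp_contDiffOn hT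
  have hi : ContDiffOn ℝ ∞ (fun z => (inner ℝ (deriv g z) (g z * deriv f z) : ℝ)) U :=
    hg'.inner ℝ (hg.mul hf')
  have hic : ContDiffOn ℝ ∞ (fun z => ((inner ℝ (deriv g z) (g z * deriv f z) : ℝ) : ℂ)) U :=
    Complex.ofRealCLM.contDiff.comp_contDiffOn hi
  have hcf : ContDiffOn ℝ ∞ (fun z => conj (deriv f z)) U :=
    Complex.conjCLE.contDiff.comp_contDiffOn hf'
  refine ContDiffOn.add (ContDiffOn.smul (hh.div (contDiffOn_const.mul (hg'.norm_sq ℝ)) ?_)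
    (contDiffOn_pt (((hTc.mul hg').mul hcf).sub ((contDiffOn_const.mul hg).mul hic))
      (contDiffOn_const.mul hi))) (hh.smul (h.isConformalSphereMap hU).smooth)
  intro z hz
  have := norm_ne_zero_iff.2 (h.deriv_ne z hz)
  positivity

theorem IsWeierstrassData.isConformalNormal (h : IsWeierstrassData f g U) (hU : IsOpen U) :
    IsConformalNormal (repFormula f g) (gaussFormula g) U where
  toIsConformalSphereMap := h.isConformalSphereMap hU
  smooth_surface := h.contDiffOn_repFormula hU
  normal z hz i := by
    have hX := differentiableAt_of_contDiffOn hU (h.contDiffOn_repFormula hU) hz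
    have hN := (h.isConformalSphereMap hU).differentiableAt hz
    -- Compare `h_{,i} = ⟨X_{,i}, N⟩ + ⟨X, N_{,i}⟩` with `⟨X, N_{,i}⟩ = h_{,i}`.
    have h1 := pd_inner hX hN i
    rw [inner_repFormula_pd (h.hol_f.differentiableAt (hU.mem_nhds hz))
      (h.hol_g.differentiableAt (hU.mem_nhds hz)) (h.deriv_ne z hz)] at h1
    simp only [inner_repFormula_gaussFormula] at h1
    change pd i (hFun f) z = _ at h1
    linarith

theorem support_repFormula (f g : ℂ → ℂ) : support (repFormula f g) (gaussFormula g) = hFun f :=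
  funext fun z => inner_repFormula_gaussFormula f g z

/-- Half the logarithmic derivative of the conformal factor `4|g'|²/T²` is the real part of the
factor `g''/g' - (2/T) g' conj g` occurring in `ξ`. -/
theorem IsWeierstrassData.pd_metricL (h : IsWeierstrassData f g U) (hU : IsOpen U) (hz : z ∈ U)
    (i : Fin 2) :
    pd i (metricL (gaussFormula g) 0 0) z = 2 * metricL (gaussFormula g) 0 0 z *
      ((deriv (deriv g) z / deriv g z - 2 / (T g z : ℂ) * deriv g z * conj (g z)) * dir i).re := by
  have hg := h.hol_g.differentiableAt (hU.mem_nhds hz)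
  have hg' := (h.hol_g.deriv hU).differentiableAt (hU.mem_nhds hz)
  have hne := h.deriv_ne z hz
  have hn := norm_ne_zero_iff.2 hne
  have hT := (T_pos g z).ne'
  -- The identity `L₁₁ T² = 4|g'|²` is differentiated.
  have h1 : Set.EqOn (fun w => metricL (gaussFormula g) 0 0 w * (T g w * T g w))
      (fun w => 4 * ‖deriv g w‖ ^ 2) U := fun w hw => by
    have := (T_pos g w).ne'
    simp only [metricL_gaussFormula (h.hol_g.differentiableAt (hU.mem_nhds hw))]
    field_simp
  have hl : DifferentiableAt ℝ (metricL (gaussFormula g) 0 0) z :=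
    have := (h.isConformalSphereMap hU).differentiableAt_pd hz 0
    this.inner ℝ this
  have ha : DifferentiableAt ℝ (fun w => ‖deriv g w‖ ^ 2) z :=
    (hg'.restrictScalars ℝ).norm_sq ℝ
  have hb : DifferentiableAt ℝ (T g) z := ((hg.restrictScalars ℝ).norm_sq ℝ).const_add 1
  have hTi : pd i (T g) z = 2 * (conj (g z) * deriv g z * dir i).re := by
    rw [← pd_norm_sq hg]
    change fderiv ℝ (fun w => 1 + ‖g w‖ ^ 2) z _ = _
    rw [fderiv_const_add]
    rfl
  have h2 := pd_congr_of_eqOn hU h1 i hz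
  rw [pd, pd, (hl.hasFDerivAt.fun_mul (hb.hasFDerivAt.fun_mul hb.hasFDerivAt)).fderiv,
    (ha.hasFDerivAt.const_mul 4).fderiv] at h2
  simp only [smul_apply, add_apply, smul_eq_mul] at h2
  have e1 : fderiv ℝ (fun w => ‖deriv g w‖ ^ 2) z (dir i)
      = 2 * (conj (deriv g z) * deriv (deriv g) z * dir i).re := pd_norm_sq hg' i
  have e2 : fderiv ℝ (T g) z (dir i) = 2 * (conj (g z) * deriv g z * dir i).re := hTi
  have e3 : (conj (deriv g z) * deriv (deriv g) z * dir i).re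
      = ‖deriv g z‖ ^ 2 * (deriv (deriv g) z / deriv g z * dir i).re := by
    rw [← Complex.re_ofReal_mul, ← Complex.normSq_eq_norm_sq, Complex.normSq_eq_conj_mul_self]
    congr 1
    field_simp
  have e4 : (2 / (T g z : ℂ) * deriv g z * conj (g z) * dir i).re
      = 2 / T g z * (conj (g z) * deriv g z * dir i).re := by
    rw [← Complex.re_ofReal_mul]
    congr 1
    push_cast
    ring
  have h3 := h1 hz
  simp only at h3
  rw [e1, e2, e3] at h2
  rw [sub_mul, Complex.sub_re, e4]
  apply mul_right_cancel₀ (pow_ne_zero 2 hT)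
  change fderiv ℝ (metricL (gaussFormula g) 0 0) z (dir i) * T g z ^ 2 = _
  generalize fderiv ℝ (metricL (gaussFormula g) 0 0) z (dir i) = x at *
  have h4 : 2 / T g z * T g z = 2 := div_mul_cancel₀ _ hT
  linear_combination h2 - 2 * (deriv (deriv g) z / deriv g z * dir i).re * h3
    + 2 * metricL (gaussFormula g) 0 0 z * (conj (g z) * deriv g z * dir i).re * T g z * h4

theorem IsWeierstrassData.pd_pd_hFun (h : IsWeierstrassData f g U) (hU : IsOpen U) (hz : z ∈ U)
    (i j : Fin 2) :
    pd j (pd i (hFun f)) z = hFun f z * ((deriv f z * dir j).re * (deriv f z * dir i).re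
      + (deriv (deriv f) z * dir i * dir j).re) := by
  have hf : ∀ w ∈ U, DifferentiableAt ℂ f w := fun w hw =>
    h.hol_f.differentiableAt (hU.mem_nhds hw)
  have hf' := (h.hol_f.deriv hU).differentiableAt (hU.mem_nhds hz)
  rw [pd_congr_of_eqOn hU (fun w hw => pd_hFun (hf w hw) i) j hz]
  have hh : DifferentiableAt ℝ (hFun f) z :=
    differentiableAt_of_contDiffOn hU (h.contDiffOn_hFun hU) hz
  have hF : DifferentiableAt ℂ (fun w => deriv f w * dir i) z := hf'.mul_const _
  have hr : DifferentiableAt ℝ (fun w => (deriv f w * dir i).re) z :=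
    Complex.reCLM.differentiableAt.comp z (hF.restrictScalars ℝ)
  have e1 : fderiv ℝ (hFun f) z (dir j) = hFun f z * (deriv f z * dir j).re := pd_hFun (hf z hz) j
  have e2 : fderiv ℝ (fun w => (deriv f w * dir i).re) z (dir j)
      = (deriv (deriv f) z * dir i * dir j).re := by
    have := pd_re hF j
    rwa [deriv_mul_const hf'] at this
  rw [pd, fderiv_fun_mul hh hr]
  simp only [add_apply, smul_apply, smul_eq_mul, e1, e2]
  ring

/-- The second fundamental form `L_{11} V` of the explicit formula, written through `f'` and `ξ`. -/
theorem IsWeierstrassData.metricL_mul_matV (h : IsWeierstrassData f g U) (hU : IsOpen U)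
    (hz : z ∈ U) :
    metricL (gaussFormula g) 0 0 z * matV (hFun f) (gaussFormula g) z 0 0
        = hFun f z * ((deriv f z).re ^ 2 - (xi f g z).re + metricL (gaussFormula g) 0 0 z) ∧
    metricL (gaussFormula g) 0 0 z * matV (hFun f) (gaussFormula g) z 0 1
        = hFun f z * (xi f g z - deriv f z ^ 2 / 2).im ∧
    metricL (gaussFormula g) 0 0 z * matV (hFun f) (gaussFormula g) z 1 1
        = hFun f z * ((Complex.I * deriv f z).re ^ 2 + (xi f g z).re
            + metricL (gaussFormula g) 0 0 z) := by
  have hn := h.isConformalSphereMap hU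
  have h0 := hn.ne_zero z hz
  have hd := hn.diag z hz
  have hf := h.hol_f.differentiableAt (hU.mem_nhds hz)
  obtain ⟨c1, c2, c3, c4, c5, c6⟩ :=
    hn.christoffel_eq hz (h.pd_metricL hU hz 0) (h.pd_metricL hU hz 1)
  have hxi : xi f g z = deriv f z * (deriv (deriv g) z / deriv g z
    - 2 / (T g z : ℂ) * deriv g z * conj (g z)) - deriv (deriv f) z := rfl
  generalize deriv (deriv g) z / deriv g z - 2 / (T g z : ℂ) * deriv g z * conj (g z) = σ at *
  refine ⟨?_, ?_, ?_⟩ <;>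
    simp only [matV, Matrix.of_apply, Fin.sum_univ_two, h.pd_pd_hFun hU hz, pd_hFun hf, c1, c2, c3,
      c4, c5, c6, ← hd, hxi, hn.off_diag z hz] <;>
    rw [mul_div_cancel₀ _ h0] <;>
    simp [dir, sq] <;> ring

end ExplicitFormula

/-! ### Change of parameters and change of normal -/

theorem support_smul {S : Type*} (X N : S → E3) (s : ℝ) (p : S) :
    support X (s • N) p = s * support X N p :=
  real_inner_smul_right _ _ _

theorem posNormal_smul {S : Type*} (X N : S → E3) {s : ℝ} (hs : s = 1 ∨ s = -1) (p : S) :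
    posNormal X (s • N) p = posNormal X N p := by
  rw [posNormal, posNormal, support_smul]
  rcases hs with rfl | rfl <;> simp [Real.sign_neg]

section Surface

variable {S : Type*} [TopologicalSpace S] [ChartedSpace ℂ S] {X N : S → E3}

/-- A Riemann surface is in particular a smooth real surface. -/
theorem isManifold_real (S : Type*) [TopologicalSpace S] [ChartedSpace ℂ S] [IsManifold 𝓘(ℂ) ω S] :
    IsManifold 𝓘(ℝ, ℂ) ∞ S := by
  refine isManifold_of_contDiffOn 𝓘(ℝ, ℂ) ∞ S fun e e' he he' => ?_
  have h := (contDiffGroupoid ω 𝓘(ℂ)).compatible he he'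
  have h2 := (contDiffGroupoid_le (I := 𝓘(ℂ)) (show (∞ : ℕ∞ω) ≤ ω from le_top) h)
  have h3 := (mem_groupoid_of_pregroupoid.1 h2).1
  exact ContDiffOn.restrict_scalars ℝ h3

theorem diff_eq_sum (Y : S → E3) (p : S) (v : ℂ) :
    diff Y p v = v.re • coordDeriv Y p 0 + v.im • coordDeriv Y p 1 := by
  have : v = v.re • dir 0 + v.im • dir 1 := by
    apply Complex.ext <;> simp [dir]
  conv_lhs => rw [this]
  simp only [map_add, map_smul, coordDeriv]

theorem IsSmoothParam.contDiffOn_comp {φ : OpenPartialHomeomorph ℂ S} (hφ : IsSmoothParam φ)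
    {Y : S → E3} (hY : ContMDiff 𝓘(ℝ, ℂ) 𝓘(ℝ, E3) ∞ Y) :
    ContDiffOn ℝ ∞ (fun w => Y (φ w)) φ.source :=
  contMDiffOn_iff_contDiffOn.1 (hY.comp_contMDiffOn hφ.1)

/-- The chain rule for a surface expressed in parameters. -/
theorem IsSmoothParam.exists_fderiv_comp [IsManifold 𝓘(ℝ, ℂ) ∞ S] {φ : OpenPartialHomeomorph ℂ S}
    (hφ : IsSmoothParam φ) {z : ℂ} (hz : z ∈ φ.source) :
    ∃ D : ℂ →L[ℝ] ℂ, Function.Injective D ∧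
      ∀ Y : S → E3, ContMDiff 𝓘(ℝ, ℂ) 𝓘(ℝ, E3) ∞ Y →
        ∀ v, fderiv ℝ (fun w => Y (φ w)) z v = diff Y (φ z) (D v) := by
  refine ⟨mfderiv 𝓘(ℝ, ℂ) 𝓘(ℝ, ℂ) φ z,
    OpenPartialHomeomorph.MDifferentiable.mfderiv_injective
      ⟨hφ.1.mdifferentiableOn (by simp), hφ.2.mdifferentiableOn (by simp)⟩ hz, fun Y hY v => ?_⟩
  have h1 : MDifferentiableAt 𝓘(ℝ, ℂ) 𝓘(ℝ, ℂ) φ z :=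
    (hφ.1.contMDiffAt (φ.open_source.mem_nhds hz)).mdifferentiableAt (by simp)
  have h2 : MDifferentiableAt 𝓘(ℝ, ℂ) 𝓘(ℝ, E3) Y (φ z) := (hY (φ z)).mdifferentiableAt (by simp)
  have h3 := mfderiv_comp z h2 h1
  rw [mfderiv_eq_fderiv] at h3
  exact congrArg (fun L : ℂ →L[ℝ] E3 => L v) h3

theorem IsSmoothParam.injective_fderiv_comp [IsManifold 𝓘(ℝ, ℂ) ∞ S]
    {φ : OpenPartialHomeomorph ℂ S} (hφ : IsSmoothParam φ) {Y : S → E3}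
    (hY : ContMDiff 𝓘(ℝ, ℂ) 𝓘(ℝ, E3) ∞ Y) {z : ℂ} (hz : z ∈ φ.source)
    (hi : Function.Injective (diff Y (φ z))) :
    Function.Injective (fderiv ℝ (fun w => Y (φ w)) z) := by
  obtain ⟨D, hD, h⟩ := hφ.exists_fderiv_comp hz
  intro v w hvw
  rw [h Y hY, h Y hY] at hvw
  exact hD (hi hvw)

/-- A change of parameters conjugates the Weingarten matrix. -/
theorem IsSmoothParam.exists_weingarten_eq [IsManifold 𝓘(ℝ, ℂ) ∞ S]
    {φ : OpenPartialHomeomorph ℂ S} (hφ : IsSmoothParam φ)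
    (hX : ContMDiff 𝓘(ℝ, ℂ) 𝓘(ℝ, E3) ∞ X) (hN : ContMDiff 𝓘(ℝ, ℂ) 𝓘(ℝ, E3) ∞ N)
    {z : ℂ} (hz : z ∈ φ.source) :
    ∃ M : Matrix (Fin 2) (Fin 2) ℝ, IsUnit M.det ∧
      weingarten (fun w => X (φ w)) (fun w => N (φ w)) z = M * weingarten X N (φ z) * M⁻¹ := by
  obtain ⟨D, hDinj, hD⟩ := hφ.exists_fderiv_comp hz
  -- `M` is the Jacobian matrix of the parametrization in the preferred chart at `φ z`.
  let M : Matrix (Fin 2) (Fin 2) ℝ := Matrix.of fun i j => ![(D (dir i)).re, (D (dir i)).im] j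
  have hc : ∀ {Y : S → E3}, ContMDiff 𝓘(ℝ, ℂ) 𝓘(ℝ, E3) ∞ Y → ∀ i,
      coordDeriv (fun w => Y (φ w)) z i = ∑ j, M i j • coordDeriv Y (φ z) j := by
    intro Y hY i
    rw [coordDeriv_eq_pd, pd, hD Y hY, diff_eq_sum, Fin.sum_univ_two]
    rfl
  have hI : firstForm (fun w => X (φ w)) z = M * firstForm X (φ z) * M.transpose := by
    ext i j
    simp only [firstForm, Matrix.of_apply, hc hX, Fin.sum_univ_two, inner_add_left,
      inner_add_right, real_inner_smul_left, real_inner_smul_right, Matrix.mul_apply,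
      Matrix.transpose_apply]
    ring
  have hII : secondForm (fun w => X (φ w)) (fun w => N (φ w)) z
      = M * secondForm X N (φ z) * M.transpose := by
    ext i j
    simp only [secondForm, Matrix.of_apply, hc hX, hc hN, Fin.sum_univ_two, inner_add_left,
      inner_add_right, real_inner_smul_left, real_inner_smul_right, Matrix.mul_apply,
      Matrix.transpose_apply]
    ring
  have hM : IsUnit M.det := by
    rw [isUnit_iff_ne_zero]
    intro h0
    obtain ⟨v, hv0, hv⟩ := Matrix.exists_vecMul_eq_zero_iff.2 h0
    have h1 : D ⟨v 0, v 1⟩ = 0 := by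
      have : (⟨v 0, v 1⟩ : ℂ) = v 0 • dir 0 + v 1 • dir 1 := by
        apply Complex.ext <;> simp [dir]
      rw [this, map_add, map_smul, map_smul]
      have e0 := congrFun hv 0
      have e1 := congrFun hv 1
      simp only [Matrix.vecMul, dotProduct, Fin.sum_univ_two, M, Matrix.of_apply,
        Pi.zero_apply] at e0 e1
      apply Complex.ext
      · simpa using e0
      · simpa using e1
    have h2 := hDinj (h1.trans (map_zero D).symm)
    refine hv0 ?_
    ext i
    fin_cases i
    · simpa using congrArg Complex.re h2
    · simpa using congrArg Complex.im h2
  refine ⟨M, hM, ?_⟩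
  have hMt : IsUnit M.transpose.det := by rwa [Matrix.det_transpose]
  rw [weingarten, weingarten, hI, hII, Matrix.mul_inv_rev, Matrix.mul_inv_rev,
    Matrix.transpose_mul, Matrix.transpose_mul, Matrix.transpose_transpose]
  simp only [Matrix.mul_assoc]
  rw [Matrix.mul_nonsing_inv_cancel_left _ _ hMt]

theorem IsSmoothParam.gaussCurvature_comp [IsManifold 𝓘(ℝ, ℂ) ∞ S]
    {φ : OpenPartialHomeomorph ℂ S} (hφ : IsSmoothParam φ)
    (hX : ContMDiff 𝓘(ℝ, ℂ) 𝓘(ℝ, E3) ∞ X) (hN : ContMDiff 𝓘(ℝ, ℂ) 𝓘(ℝ, E3) ∞ N)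
    {z : ℂ} (hz : z ∈ φ.source) :
    gaussCurvature (fun w => X (φ w)) (fun w => N (φ w)) z = gaussCurvature X N (φ z) := by
  obtain ⟨M, hM, h⟩ := hφ.exists_weingarten_eq hX hN hz
  rw [gaussCurvature, gaussCurvature, h, Matrix.det_mul, Matrix.det_mul, mul_comm, ← mul_assoc,
    Matrix.det_nonsing_inv_mul_det _ hM, one_mul]

theorem IsSmoothParam.ssAt_comp [IsManifold 𝓘(ℝ, ℂ) ∞ S]
    {φ : OpenPartialHomeomorph ℂ S} (hφ : IsSmoothParam φ)
    (hX : ContMDiff 𝓘(ℝ, ℂ) 𝓘(ℝ, E3) ∞ X) (hN : ContMDiff 𝓘(ℝ, ℂ) 𝓘(ℝ, E3) ∞ N)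
    {z : ℂ} (hz : z ∈ φ.source) :
    SSAt (fun w => X (φ w)) (fun w => N (φ w)) z ↔ SSAt X N (φ z) := by
  obtain ⟨M, hM, h⟩ := hφ.exists_weingarten_eq hX hN hz
  have hH : meanCurvature (fun w => X (φ w)) (fun w => N (φ w)) z = meanCurvature X N (φ z) := by
    rw [meanCurvature, meanCurvature, h, Matrix.trace_mul_cycle, Matrix.nonsing_inv_mul _ hM,
      Matrix.one_mul]
  rw [SSAt, SSAt, hH, hφ.gaussCurvature_comp hX hN hz]
  rfl

theorem weingarten_smul (s : ℝ) {p : S} (hN : MDifferentiableAt 𝓘(ℝ, ℂ) 𝓘(ℝ, E3) N p) :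
    weingarten X (s • N) p = s • weingarten X N p := by
  have h : ∀ i, coordDeriv (s • N) p i = s • coordDeriv N p i := fun i => by
    have := const_smul_mfderiv hN s
    simp only [coordDeriv, diff, this]
    rfl
  have h2 : secondForm X (s • N) p = s • secondForm X N p := by
    ext i j
    simp [secondForm, h, inner_smul_right]
  rw [weingarten, h2, weingarten, Matrix.transpose_smul, Matrix.smul_mul]

theorem gaussCurvature_smul {s : ℝ} (hs : s ^ 2 = 1) {p : S}
    (hN : MDifferentiableAt 𝓘(ℝ, ℂ) 𝓘(ℝ, E3) N p) :
    gaussCurvature X (s • N) p = gaussCurvature X N p := by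
  rw [gaussCurvature, gaussCurvature, weingarten_smul s hN, Matrix.det_smul, Fintype.card_fin, hs,
    one_mul]

/-- The relation does not depend on the choice of the normal. -/
theorem ssAt_smul {s : ℝ} (hs : s ^ 2 = 1) {p : S}
    (hN : MDifferentiableAt 𝓘(ℝ, ℂ) 𝓘(ℝ, E3) N p) : SSAt X (s • N) p ↔ SSAt X N p := by
  have hH : meanCurvature X (s • N) p = s * meanCurvature X N p := by
    rw [meanCurvature, meanCurvature, weingarten_smul s hN, Matrix.trace_smul, smul_eq_mul]
    ring
  have h : 2 * (s * support X N p) * (s * meanCurvature X N p)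
      = s ^ 2 * (2 * support X N p * meanCurvature X N p) := by ring
  rw [SSAt, SSAt, hH, gaussCurvature_smul hs hN, support_smul, h, mul_pow, hs, one_mul, one_mul]

theorem IsGaussMap.smul (hN : IsGaussMap X N) {s : ℝ} (hs : s = 1 ∨ s = -1) :
    IsGaussMap X (s • N) where
  smooth := (contDiff_const_smul s).contMDiff.comp hN.smooth
  unit p := by
    rw [Pi.smul_apply, norm_smul, hN.unit]
    rcases hs with rfl | rfl <;> simp
  normal p v := by
    rw [Pi.smul_apply, real_inner_smul_right, hN.normal, mul_zero]

theorem IsGaussMap.mdifferentiableAt (hN : IsGaussMap X N) (p : S) :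
    MDifferentiableAt 𝓘(ℝ, ℂ) 𝓘(ℝ, E3) N p :=
  (hN.smooth p).mdifferentiableAt (by simp)

/-- Where `K ≠ 0` the Gauss map is an immersion. -/
theorem injective_diff_of_gaussCurvature_ne_zero {p : S} (hK : gaussCurvature X N p ≠ 0) :
    Function.Injective (diff N p) := by
  have hII : (secondForm X N p).det ≠ 0 := by
    intro h
    refine hK ?_
    rw [gaussCurvature, weingarten, Matrix.det_mul, Matrix.det_transpose, h, zero_mul]
  rw [injective_iff_map_eq_zero]
  intro v hv
  by_contra hv0
  refine hII (Matrix.exists_mulVec_eq_zero_iff.1 ⟨![v.re, v.im], fun h => hv0 ?_, ?_⟩)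
  · apply Complex.ext
    · simpa using congrFun h 0
    · simpa using congrFun h 1
  · ext i
    have : inner ℝ (coordDeriv X p i) (diff N p v) = 0 := by rw [hv, inner_zero_right]
    rw [diff_eq_sum, inner_add_right, real_inner_smul_right, real_inner_smul_right] at this
    simp only [Matrix.mulVec, dotProduct, Fin.sum_univ_two, secondForm, Matrix.of_apply,
      Matrix.cons_val, Pi.zero_apply]
    linarith

end Surface

theorem weingarten_congr {Y Y' n n' : ℂ → E3} {z : ℂ} (hY : Y =ᶠ[𝓝 z] Y') (hn : n =ᶠ[𝓝 z] n') :
    weingarten Y n z = weingarten Y' n' z := by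
  have h1 : ∀ i, coordDeriv Y z i = coordDeriv Y' z i := fun i => by
    rw [coordDeriv_eq_pd, coordDeriv_eq_pd, pd, pd, hY.fderiv_eq]
  have h2 : ∀ i, coordDeriv n z i = coordDeriv n' z i := fun i => by
    rw [coordDeriv_eq_pd, coordDeriv_eq_pd, pd, pd, hn.fderiv_eq]
  simp only [weingarten, firstForm, secondForm, h1, h2]

theorem ssAt_congr {Y Y' n n' : ℂ → E3} {z : ℂ} (hY : Y =ᶠ[𝓝 z] Y') (hn : n =ᶠ[𝓝 z] n') :
    SSAt Y n z ↔ SSAt Y' n' z := by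
  simp only [SSAt, support, quadDist, meanCurvature, gaussCurvature, weingarten_congr hY hn,
    hY.self_of_nhds, hn.self_of_nhds]

/-! ### Parameters given by the Gauss map -/

theorem stereo_apply (w : ℂ) : stereo w 0 = (T id w)⁻¹ * (2 * w.re) ∧
    stereo w 1 = (T id w)⁻¹ * (2 * w.im) ∧ stereo w 2 = (T id w)⁻¹ * (2 - T id w) := by
  refine ⟨?_, ?_, ?_⟩ <;> simp [stereo, gaussFormula, pt]

/-- Stereographic projection from the south pole. -/
noncomputable def stereoProj (y : E3) : ℂ := ((1 + y 2)⁻¹ : ℝ) • (⟨y 0, y 1⟩ : ℂ)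

theorem sum_sq_eq_one {y : E3} (hy : ‖y‖ = 1) : y 0 ^ 2 + y 1 ^ 2 + y 2 ^ 2 = 1 := by
  have h := EuclideanSpace.real_norm_sq_eq y
  rw [hy, Fin.sum_univ_three] at h
  linarith

theorem stereo_stereoProj {y : E3} (hy : ‖y‖ = 1) (h2 : 1 + y 2 ≠ 0) :
    stereo (stereoProj y) = y := by
  have hs := sum_sq_eq_one hy
  have hre : (stereoProj y).re = (1 + y 2)⁻¹ * y 0 := Complex.smul_re _ _
  have him : (stereoProj y).im = (1 + y 2)⁻¹ * y 1 := Complex.smul_im _ _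
  have hT : T id (stereoProj y) = 2 / (1 + y 2) := by
    rw [T_eq, id, hre, him]
    field_simp
    linarith
  obtain ⟨e0, e1, e2⟩ := stereo_apply (stereoProj y)
  ext i
  fin_cases i
  · refine e0.trans ?_
    rw [hT, hre]
    simp
    field_simp
  · refine e1.trans ?_
    rw [hT, him]
    simp
    field_simp
  · refine e2.trans ?_
    rw [hT]
    simp
    field_simp
    ring

theorem one_add_ne_zero_of_ne {y : E3} (hy : ‖y‖ = 1) (hne : y ≠ pt 0 (-1)) : 1 + y 2 ≠ 0 := by
  intro h
  have hs := sum_sq_eq_one hy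
  have h2 : y 2 = -1 := by linarith
  rw [h2] at hs
  have h0 : y 0 = 0 := by nlinarith [sq_nonneg (y 0), sq_nonneg (y 1)]
  have h1 : y 1 = 0 := by nlinarith [sq_nonneg (y 0), sq_nonneg (y 1)]
  refine hne ?_
  ext i
  fin_cases i
  · simpa [pt] using h0
  · simpa [pt] using h1
  · simpa [pt] using h2

theorem contDiffOn_stereoProj : ContDiffOn ℝ ∞ stereoProj {y | 1 + y 2 ≠ 0} := by
  have h : ∀ i : Fin 3, ContDiff ℝ ∞ (fun y : E3 => y i) := fun i =>
    (EuclideanSpace.proj i : E3 →L[ℝ] ℝ).contDiff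
  have hc : ContDiff ℝ ∞ (fun y : E3 => (⟨y 0, y 1⟩ : ℂ)) := by
    have : (fun y : E3 => (⟨y 0, y 1⟩ : ℂ)) = fun y : E3 => y 0 • (1 : ℂ) + y 1 • Complex.I := by
      funext y
      apply Complex.ext <;> simp
    rw [this]
    exact ((h 0).smul contDiff_const).add ((h 1).smul contDiff_const)
  exact ((contDiff_const.add (h 2)).contDiffOn.inv fun y hy => hy).smul hc.contDiffOn

variable {S : Type*} [TopologicalSpace S] [ChartedSpace ℂ S] {X N : S → E3}

theorem IsSmoothParam.trans {φ : OpenPartialHomeomorph ℂ S} (hφ : IsSmoothParam φ)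
    {e : OpenPartialHomeomorph ℂ ℂ} (he : ContDiffOn ℝ ∞ e e.source)
    (he' : ContDiffOn ℝ ∞ e.symm e.target) : IsSmoothParam (e.trans φ) := by
  constructor
  · rw [OpenPartialHomeomorph.trans_source]
    exact hφ.1.comp' (contMDiffOn_iff_contDiffOn.2 he)
  · rw [OpenPartialHomeomorph.trans_target]
    exact (contMDiffOn_iff_contDiffOn.2 he').comp' hφ.2

theorem IsSmoothParam.restrOpen {φ : OpenPartialHomeomorph ℂ S} (hφ : IsSmoothParam φ) (s : Set ℂ)
    (hs : IsOpen s) : IsSmoothParam (φ.restrOpen s hs) :=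
  ⟨hφ.1.mono Set.inter_subset_left, hφ.2.mono Set.inter_subset_left⟩

/-- A smooth map between open sets of the plane with injective differentials is locally a
diffeomorphism. -/
theorem exists_openPartialHomeomorph {F : ℂ → ℂ} {O : Set ℂ} (hO : IsOpen O)
    (hF : ContDiffOn ℝ ∞ F O) (hi : ∀ z ∈ O, Function.Injective (fderiv ℝ F z)) {z : ℂ}
    (hz : z ∈ O) :
    ∃ e : OpenPartialHomeomorph ℂ ℂ, z ∈ e.source ∧ e.source ⊆ O ∧ (e : ℂ → ℂ) = F ∧
      ContDiffOn ℝ ∞ e.symm e.target := by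
  have hc : ∀ w ∈ O, ContDiffAt ℝ ∞ F w := fun w hw => hF.contDiffAt (hO.mem_nhds hw)
  have hd : ∀ w ∈ O, ∃ L : ℂ ≃L[ℝ] ℂ, HasFDerivAt F (L : ℂ →L[ℝ] ℂ) w := fun w hw => by
    let L := (LinearEquiv.ofInjectiveEndo (fderiv ℝ F w : ℂ →ₗ[ℝ] ℂ)
      (hi w hw)).toContinuousLinearEquiv
    refine ⟨L, ?_⟩
    have : (L : ℂ →L[ℝ] ℂ) = fderiv ℝ F w := by
      ext v
      rfl
    rw [this]
    exact ((hc w hw).differentiableAt (by simp)).hasFDerivAt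
  obtain ⟨L, hL⟩ := hd z hz
  let e := ((hc z hz).toOpenPartialHomeomorph F hL (by simp)).restrOpen O hO
  have heF : (e : ℂ → ℂ) = F := rfl
  have hsub : e.source ⊆ O := Set.inter_subset_right
  refine ⟨e, ⟨(hc z hz).mem_toOpenPartialHomeomorph_source hL (by simp), hz⟩, hsub, heF, ?_⟩
  intro w hw
  have hw' := hsub (e.map_target hw)
  obtain ⟨L', hL'⟩ := hd _ hw'
  exact (e.contDiffAt_symm hw (f₀' := L') hL' (hc _ hw')).contDiffWithinAt

/-- Where `K ≠ 0` and the normal is not the south pole, stereographic projection of the normal is a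
local coordinate on the surface. -/
theorem exists_param_of_gaussMap [IsManifold 𝓘(ℝ, ℂ) ∞ S] (hN : IsGaussMap X N)
    (hK : ∀ p, gaussCurvature X N p ≠ 0) {p : S} (hp : N p ≠ pt 0 (-1)) :
    ∃ φ : OpenPartialHomeomorph ℂ S, IsSmoothParam φ ∧ p ∈ φ.target ∧
      ∀ z ∈ φ.source, N (φ z) = gaussFormula id z := by
  let c : OpenPartialHomeomorph ℂ S := (chartAt ℂ p).symm
  have hc : IsSmoothParam c := ⟨contMDiffOn_chart_symm, contMDiffOn_chart⟩
  have hpc : p ∈ c.target := mem_chart_source ℂ p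
  have hNc : ContDiffOn ℝ ∞ (fun w => N (c w)) c.source := hc.contDiffOn_comp hN.smooth
  have hopen : IsOpen {y : E3 | 1 + y 2 ≠ 0} :=
    isOpen_ne.preimage (continuous_const.add (EuclideanSpace.proj (2 : Fin 3)).continuous)
  let O := c.source ∩ (fun w => N (c w)) ⁻¹' {y : E3 | 1 + y 2 ≠ 0}
  have hO : IsOpen O := hNc.continuousOn.isOpen_inter_preimage c.open_source hopen
  let G : ℂ → ℂ := fun w => stereoProj (N (c w))
  have hG : ContDiffOn ℝ ∞ G O :=
    contDiffOn_stereoProj.comp (hNc.mono Set.inter_subset_left) fun w hw => hw.2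
  have hsG : ∀ w ∈ O, stereo (G w) = N (c w) := fun w hw => stereo_stereoProj (hN.unit _) hw.2
  have hGi : ∀ w ∈ O, Function.Injective (fderiv ℝ G w) := fun w hw => by
    have hi := hc.injective_fderiv_comp hN.smooth hw.1
      (injective_diff_of_gaussCurvature_ne_zero (hK (c w)))
    have heq : (fun w => N (c w)) =ᶠ[𝓝 w] stereo ∘ G := by
      filter_upwards [hO.mem_nhds hw] with x hx using (hsG x hx).symm
    rw [heq.fderiv_eq, fderiv_comp w (contDiff_stereo.differentiable (by simp) _)
      (differentiableAt_of_contDiffOn hO hG hw)] at hi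
    exact Function.Injective.of_comp hi
  have hz : c.symm p ∈ O := by
    refine ⟨c.map_target hpc, ?_⟩
    change 1 + N (c (c.symm p)) 2 ≠ 0
    rw [c.right_inv hpc]
    exact one_add_ne_zero_of_ne (hN.unit p) hp
  obtain ⟨e, hze, heO, heG, hes⟩ := exists_openPartialHomeomorph hO hG hGi hz
  refine ⟨e.symm.trans c, hc.trans hes ?_, ?_, ?_⟩
  · rw [OpenPartialHomeomorph.symm_symm, OpenPartialHomeomorph.symm_target, heG]
    exact hG.mono heO
  · rw [OpenPartialHomeomorph.trans_target]
    exact ⟨hpc, hze⟩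
  · intro z hz
    rw [OpenPartialHomeomorph.trans_source] at hz
    have h := hsG _ (heO (e.map_target hz.1))
    rw [OpenPartialHomeomorph.coe_trans, Function.comp_apply, ← h, ← heG, e.right_inv hz.1]
    rfl

/-! ### Harmonicity of the logarithm of the support function -/

theorem continuousOn_mul_laplacian_sub {h : ℂ → ℝ} {U : Set ℂ} (hU : IsOpen U)
    (hh : ContDiffOn ℝ ∞ h U) :
    ContinuousOn (fun z => h z * Laplacian.laplacian h z - (pd 0 h z ^ 2 + pd 1 h z ^ 2)) U := by
  have h1 : ContinuousOn
      (fun z => h z * (pd 0 (pd 0 h) z + pd 1 (pd 1 h) z) - (pd 0 h z ^ 2 + pd 1 h z ^ 2)) U := by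
    have p := fun i : Fin 2 => contDiffOn_pd hU hh i
    have pp := fun i : Fin 2 => contDiffOn_pd hU (p i) i
    exact (hh.continuousOn.mul ((pp 0).continuousOn.add (pp 1).continuousOn)).sub
      (((p 0).continuousOn.pow 2).add ((p 1).continuousOn.pow 2))
  refine h1.congr fun z hz => ?_
  simp only [laplacian_eq_pd hU hh hz]

theorem laplacian_log_abs {h : ℂ → ℝ} {U : Set ℂ} (hU : IsOpen U) (hh : ContDiffOn ℝ ∞ h U)
    (h0 : ∀ z ∈ U, h z ≠ 0) {z : ℂ} (hz : z ∈ U) :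
    Laplacian.laplacian (fun w => Real.log |h w|) z
      = (h z * Laplacian.laplacian h z - (pd 0 h z ^ 2 + pd 1 h z ^ 2)) / h z ^ 2 := by
  simp only [Real.log_abs]
  have hlog : ContDiffOn ℝ ∞ (fun w => Real.log (h w)) U := hh.log h0
  have hz0 := h0 z hz
  have h1 : ∀ i, Set.EqOn (pd i (fun w => Real.log (h w))) (fun w => (h w)⁻¹ * pd i h w) U := by
    intro i w hw
    have := (differentiableAt_of_contDiffOn hU hh hw).hasFDerivAt.log (h0 w hw)
    rw [pd, this.fderiv]
    rfl
  have h2 : ∀ i, pd i (pd i (fun w => Real.log (h w))) z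
      = (h z * pd i (pd i h) z - pd i h z ^ 2) / h z ^ 2 := by
    intro i
    have hd := differentiableAt_of_contDiffOn hU hh hz
    have hp := differentiableAt_of_contDiffOn hU (contDiffOn_pd hU hh i) hz
    have hinv : HasFDerivAt (fun w => (h w)⁻¹) _ z :=
      (hasDerivAt_inv hz0).comp_hasFDerivAt z hd.hasFDerivAt
    rw [pd_congr_of_eqOn hU (h1 i) i hz, pd, (hinv.fun_mul hp.hasFDerivAt).fderiv]
    simp only [add_apply, smul_apply, smul_eq_mul]
    change _ * pd i (pd i h) z + pd i h z * (_ * pd i h z) = _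
    field_simp
    ring
  rw [laplacian_eq_pd hU hlog hz, h2, h2, laplacian_eq_pd hU hh hz]
  ring

theorem harmonicOnNhd_log_abs_iff {h : ℂ → ℝ} {U : Set ℂ} (hU : IsOpen U)
    (hh : ContDiffOn ℝ ∞ h U) (h0 : ∀ z ∈ U, h z ≠ 0) :
    InnerProductSpace.HarmonicOnNhd (fun w => Real.log |h w|) U ↔
      ∀ z ∈ U, h z * Laplacian.laplacian h z - (pd 0 h z ^ 2 + pd 1 h z ^ 2) = 0 := by
  have hlog : ContDiffOn ℝ ∞ (fun w => Real.log |h w|) U := by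
    simp only [Real.log_abs]
    exact hh.log h0
  have key : ∀ z ∈ U, Laplacian.laplacian (fun w => Real.log |h w|) z = 0 ↔
      h z * Laplacian.laplacian h z - (pd 0 h z ^ 2 + pd 1 h z ^ 2) = 0 := fun z hz => by
    rw [laplacian_log_abs hU hh h0 hz, div_eq_zero_iff, or_iff_left (pow_ne_zero 2 (h0 z hz))]
  constructor
  · intro H z hz
    exact (key z hz).1 (H z hz).2.self_of_nhds
  · intro H z hz
    refine ⟨(hlog.contDiffAt (hU.mem_nhds hz)).of_le (by norm_cast), ?_⟩
    filter_upwards [hU.mem_nhds hz] with w hw using (key w hw).2 (H w hw)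

/-! ### Immersed surfaces of nonzero curvature in parameters with conformal Gauss map -/

section Surface

variable {S : Type*} [TopologicalSpace S] [ChartedSpace ℂ S] {X N : S → E3}

theorem isConformalNormal_of_eqOn [IsManifold 𝓘(ℝ, ℂ) ∞ S] (hX : IsImmersion X)
    (hN : IsGaussMap X N) {φ : OpenPartialHomeomorph ℂ S} (hφ : IsSmoothParam φ) {n : ℂ → E3}
    (hn : IsConformalSphereMap n φ.source) (h : ∀ z ∈ φ.source, N (φ z) = n z) :
    IsConformalNormal (fun w => X (φ w)) n φ.source where
  toIsConformalSphereMap := hn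
  smooth_surface := hφ.contDiffOn_comp hX.smooth
  normal z hz i := by
    obtain ⟨D, -, hD⟩ := hφ.exists_fderiv_comp hz
    rw [pd, hD X hX.smooth, ← h z hz, hN.normal]

theorem IsConformalNormal.det_matV_ne_zero [IsManifold 𝓘(ℝ, ℂ) ∞ S] (hX : IsImmersion X)
    {φ : OpenPartialHomeomorph ℂ S} (hφ : IsSmoothParam φ) {n : ℂ → E3}
    (hY : IsConformalNormal (fun w => X (φ w)) n φ.source) {z : ℂ} (hz : z ∈ φ.source) :
    (matV (support (fun w => X (φ w)) n) n z).det ≠ 0 :=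
  (hY.injective_iff hz).1 (hφ.injective_fderiv_comp hX.smooth hz (hX.injective _))

theorem ssAt_iff_of_isConformalNormal [IsManifold 𝓘(ℝ, ℂ) ∞ S] (hX : IsImmersion X)
    (hN : IsGaussMap X N) {φ : OpenPartialHomeomorph ℂ S} (hφ : IsSmoothParam φ) {n : ℂ → E3}
    (h : ∀ z ∈ φ.source, N (φ z) = n z)
    (hY : IsConformalNormal (fun w => X (φ w)) n φ.source) {z : ℂ} (hz : z ∈ φ.source) :
    SSAt X N (φ z) ↔ support (fun w => X (φ w)) n z
        * Laplacian.laplacian (support (fun w => X (φ w)) n) z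
      - (pd 0 (support (fun w => X (φ w)) n) z ^ 2
        + pd 1 (support (fun w => X (φ w)) n) z ^ 2) = 0 := by
  rw [← hφ.ssAt_comp hX.smooth hN.smooth hz, ← hY.ssAt_iff hz (hY.det_matV_ne_zero hX hφ hz)]
  refine ssAt_congr EventuallyEq.rfl ?_
  filter_upwards [φ.open_source.mem_nhds hz] with w hw using h w hw

theorem isConformalSphereMap_comp [IsManifold 𝓘(ℝ, ℂ) ∞ S]
    (hN : IsGaussMap X N) (hK : ∀ p, gaussCurvature X N p ≠ 0)
    {φ : OpenPartialHomeomorph ℂ S} (hφ : IsSmoothParam φ)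
    (hd : ∀ z ∈ φ.source, metricL (fun w => N (φ w)) 0 0 z = metricL (fun w => N (φ w)) 1 1 z ∧
      metricL (fun w => N (φ w)) 0 1 z = 0) :
    IsConformalSphereMap (fun w => N (φ w)) φ.source where
  isOpen := φ.open_source
  smooth := hφ.contDiffOn_comp hN.smooth
  unit z _ := hN.unit _
  diag z hz := (hd z hz).1
  off_diag z hz := (hd z hz).2
  ne_zero z hz h0 := by
    have hi := hφ.injective_fderiv_comp hN.smooth hz
      (injective_diff_of_gaussCurvature_ne_zero (hK (φ z)))
    have h1 : fderiv ℝ (fun w => N (φ w)) z (dir 0) = 0 := inner_self_eq_zero.1 h0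
    have h2 := congrArg Complex.re (hi (h1.trans (map_zero _).symm))
    simp [dir] at h2

/-! ### Local representations of immersed surfaces -/

variable {f g : ℂ → ℂ}

/-- `h = e^{Re f}` has harmonic logarithm. -/
theorem IsWeierstrassData.laplacian_hFun {U : Set ℂ} (h : IsWeierstrassData f g U)
    (hU : IsOpen U) {z : ℂ} (hz : z ∈ U) :
    hFun f z * Laplacian.laplacian (hFun f) z - (pd 0 (hFun f) z ^ 2 + pd 1 (hFun f) z ^ 2) = 0 := by
  have hf := h.hol_f.differentiableAt (hU.mem_nhds hz)
  rw [laplacian_eq_pd hU (h.contDiffOn_hFun hU) hz, h.pd_pd_hFun hU hz, h.pd_pd_hFun hU hz,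
    pd_hFun hf, pd_hFun hf]
  simp [dir]
  ring

/-- Two unit normals of an immersed surface are proportional. -/
theorem IsConformalNormal.eq_smul_of_normal {Y n : ℂ → E3} {U : Set ℂ}
    (hY : IsConformalNormal Y n U) {z : ℂ} (hz : z ∈ U)
    (hV : (matV (support Y n) n z).det ≠ 0) {v : E3} (hv : ∀ j, inner ℝ (pd j Y z) v = 0) :
    v = inner ℝ v (n z) • n z := by
  set V := matV (support Y n) n z
  -- `V` is invertible, so the tangent vectors `Y_{,j}` span `n_{,1}, n_{,2}`.
  have hvn : ∀ i, inner ℝ v (pd i n z) = 0 := by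
    have h1 : V.transpose.mulVec (fun i => inner ℝ v (pd i n z)) = 0 := by
      ext j
      have := hv j
      rw [hY.pd_eq_sum hz, real_inner_comm, inner_sum] at this
      simpa [Matrix.mulVec, dotProduct, real_inner_smul_right] using this
    have h2 : V.transpose.det ≠ 0 := by rwa [Matrix.det_transpose]
    exact fun i => congrFun (Matrix.eq_zero_of_mulVec_eq_zero h2 h1) i
  refine hY.ext_frame hz ?_ fun i => ?_
  · rw [real_inner_smul_left, real_inner_self_eq_norm_sq, hY.unit z hz]
    ring
  · rw [hvn, real_inner_smul_left, real_inner_comm (pd i n z), hY.inner_pd_self hz,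
      mul_zero]

/-- Near each point of a local representation, the given normal agrees with the one of the formula
up to a constant sign. -/
theorem IsRepresentation.exists_sign [IsManifold 𝓘(ℝ, ℂ) ∞ S] (hX : IsImmersion X)
    (hN : IsGaussMap X N) {φ : OpenPartialHomeomorph ℂ S} (h : IsRepresentation X φ f g) {z : ℂ}
    (hz : z ∈ φ.source) :
    ∃ s : ℝ, (s = 1 ∨ s = -1) ∧
      (fun w => N (φ w)) =ᶠ[𝓝 z] s • gaussFormula g := by
  have hU := φ.open_source
  have hR := h.data.isConformalNormal hU
  have heq : ∀ w ∈ φ.source, (fun w => X (φ w)) =ᶠ[𝓝 w] repFormula f g := fun w hw => by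
    filter_upwards [hU.mem_nhds hw] with x hx using h.eq x hx
  have hprop : ∀ w ∈ φ.source,
      N (φ w) = inner ℝ (N (φ w)) (gaussFormula g w) • gaussFormula g w := by
    intro w hw
    obtain ⟨D, -, hD⟩ := h.param.exists_fderiv_comp hw
    refine hR.eq_smul_of_normal hw ((hR.injective_iff hw).1 ?_) fun j => ?_
    · rw [← (heq w hw).fderiv_eq]
      exact h.param.injective_fderiv_comp hX.smooth hw (hX.injective _)
    · rw [pd, ← (heq w hw).fderiv_eq, hD X hX.smooth, hN.normal]
  have hc : ∀ w ∈ φ.source, inner ℝ (N (φ w)) (gaussFormula g w) = (1 : ℝ) ∨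
      inner ℝ (N (φ w)) (gaussFormula g w) = (-1 : ℝ) := by
    intro w hw
    have h1 := congrArg norm (hprop w hw)
    rw [norm_smul, hN.unit, hR.unit w hw, mul_one, Real.norm_eq_abs] at h1
    exact eq_or_eq_neg_of_abs_eq h1.symm
  have hcont : ContinuousAt (fun w => (inner ℝ (N (φ w)) (gaussFormula g w) : ℝ)) z :=
    ((h.param.contDiffOn_comp hN.smooth).continuousOn.continuousAt (hU.mem_nhds hz)).inner
      (hR.smooth.continuousOn.continuousAt (hU.mem_nhds hz))
  -- A continuous function with values `±1` is locally constant.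
  refine ⟨_, hc z hz, ?_⟩
  have hev : ∀ᶠ w in 𝓝 z, |inner ℝ (N (φ w)) (gaussFormula g w)
      - inner ℝ (N (φ z)) (gaussFormula g z)| < (1 : ℝ) := by
    have := Metric.continuousAt_iff'.1 hcont 1 one_pos
    simpa [Real.dist_eq] using this
  filter_upwards [hev, hU.mem_nhds hz] with w hw hws
  rw [Pi.smul_apply, hprop w hws]
  congr 1
  rcases hc w hws with h1 | h1 <;> rcases hc z hz with h2 | h2 <;> rw [h1, h2] at hw ⊢ <;>
    norm_num at hw

theorem IsRepresentation.properties [IsManifold 𝓘(ℝ, ℂ) ∞ S] (hX : IsImmersion X)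
    (hN : IsGaussMap X N) {φ : OpenPartialHomeomorph ℂ S} (h : IsRepresentation X φ f g) {z : ℂ}
    (hz : z ∈ φ.source) :
    SSAt X N (φ z) ∧ support X N (φ z) ≠ 0 ∧ posNormal X N (φ z) = gaussFormula g z ∧
      |support X N (φ z)| = hFun f z ∧
      (matV (hFun f) (gaussFormula g) z).det = 1 / gaussCurvature X N (φ z) ∧
      (matV (hFun f) (gaussFormula g) z).det ≠ 0 := by
  have hU := φ.open_source
  have hR := h.data.isConformalNormal hU
  obtain ⟨s, hs, hsN⟩ := h.exists_sign hX hN hz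
  have hs2 : s ^ 2 = 1 := by rcases hs with rfl | rfl <;> norm_num
  have heq : (fun w => X (φ w)) =ᶠ[𝓝 z] repFormula f g := by
    filter_upwards [hU.mem_nhds hz] with x hx using h.eq x hx
  have hdN : MDifferentiableAt 𝓘(ℝ, ℂ) 𝓘(ℝ, E3) (gaussFormula g) z :=
    (hR.differentiableAt hz).mdifferentiableAt
  have hV : (matV (support (repFormula f g) (gaussFormula g)) (gaussFormula g) z).det ≠ 0 := by
    rw [← hR.injective_iff hz, ← heq.fderiv_eq]
    exact h.param.injective_fderiv_comp hX.smooth hz (hX.injective _)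
  have hK : gaussCurvature X N (φ z) = gaussCurvature (repFormula f g) (gaussFormula g) z := by
    rw [← gaussCurvature_smul hs2 hdN, ← h.param.gaussCurvature_comp hX.smooth hN.smooth hz,
      gaussCurvature, gaussCurvature, weingarten_congr heq hsN]
  have hψ : support X N (φ z) = s * hFun f z := by
    rw [← support_repFormula f g, ← support_smul, support, support, h.eq z hz]
    exact congrArg _ hsN.self_of_nhds
  have hpos : 0 < hFun f z := Real.exp_pos _
  refine ⟨?_, ?_, ?_, ?_, ?_, ?_⟩
  · rw [← h.param.ssAt_comp hX.smooth hN.smooth hz, ssAt_congr heq hsN, ssAt_smul hs2 hdN,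
      hR.ssAt_iff hz hV, support_repFormula]
    exact h.data.laplacian_hFun hU hz
  · rw [hψ]
    rcases hs with rfl | rfl <;> simp [hpos.ne']
  · have : N (φ z) = s • gaussFormula g z := hsN.self_of_nhds
    rw [posNormal, hψ, this]
    rcases hs with rfl | rfl <;> simp [Real.sign_neg, Real.sign_of_pos hpos]
  · rw [hψ]
    rcases hs with rfl | rfl <;> simp [abs_of_pos hpos]
  · rw [hK, hR.gaussCurvature_eq hz hV, support_repFormula, one_div_one_div]
  · rwa [support_repFormula] at hV

/-! ### The representation theorem -/

theorem isWeierstrassData_id {U : Set ℂ} (hf : DifferentiableOn ℂ f U) :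
    IsWeierstrassData f id U where
  hol_f := hf
  hol_g := differentiableOn_id
  deriv_ne z _ := by simp

/-- An SS-surface is given by the formula, with `g(z) = z`, near a point where the support function
is positive and the normal is not the south pole. -/
theorem exists_isRepresentation [IsManifold 𝓘(ℝ, ℂ) ∞ S] (hX : IsImmersion X)
    (hN : IsGaussMap X N) (hK : ∀ p, gaussCurvature X N p ≠ 0) (hSS : IsSS X N) {p : S}
    (hψ : 0 < support X N p) (hp : N p ≠ pt 0 (-1)) :
    ∃ (φ : OpenPartialHomeomorph ℂ S) (f g : ℂ → ℂ),
      p ∈ φ.target ∧ IsRepresentation X φ f g := by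
  obtain ⟨φ, hφ, hpφ, hNφ⟩ := exists_param_of_gaussMap hN hK hp
  have hU := φ.open_source
  have hY := isConformalNormal_of_eqOn hX hN hφ
    ((isWeierstrassData_id (differentiableOn_const 0)).isConformalSphereMap hU) hNφ
  set h := support (fun w => X (φ w)) (gaussFormula id) with hh
  have hz₀ := φ.map_target hpφ
  have hpos₀ : 0 < h (φ.symm p) := by
    rw [hh, support, ← hNφ _ hz₀, φ.right_inv hpφ]
    exact hψ
  have hcont := hY.smooth_support.continuousOn
  obtain ⟨r, hr, hball⟩ := Metric.mem_nhds_iff.1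
    ((hcont.isOpen_inter_preimage hU isOpen_Ioi).mem_nhds ⟨hz₀, hpos₀⟩)
  set B := Metric.ball (φ.symm p) r
  have hBU : B ⊆ φ.source := fun z hz => (hball hz).1
  have hBpos : ∀ z ∈ B, 0 < h z := fun z hz => (hball hz).2
  have hharm : InnerProductSpace.HarmonicOnNhd (fun w => Real.log |h w|) B :=
    (harmonicOnNhd_log_abs_iff Metric.isOpen_ball (hY.smooth_support.mono hBU)
      fun z hz => (hBpos z hz).ne').2 fun z hz =>
      (ssAt_iff_of_isConformalNormal hX hN hφ hNφ hY (hBU hz)).1 (hSS _)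
  obtain ⟨F, hF, hFeq⟩ := hharm.exists_analyticOnNhd_ball_re_eq
  have hW : IsWeierstrassData F id B := isWeierstrassData_id hF.differentiableOn
  have hFh : Set.EqOn h (hFun F) B := fun z hz => by
    have := hFeq hz
    simp only at this
    rw [hFun, this, Real.exp_log (abs_pos.2 (hBpos z hz).ne'), abs_of_pos (hBpos z hz)]
  -- The formula and `X` have the same normal and the same support function on `B`.
  have hsrc : (φ.restrOpen B Metric.isOpen_ball).source = B :=
    Set.inter_eq_right.2 hBU
  refine ⟨φ.restrOpen B Metric.isOpen_ball, F, id, ?_, hφ.restrOpen _ _, by rwa [hsrc], ?_⟩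
  · exact ⟨hpφ, Metric.mem_ball_self hr⟩
  · intro z hz
    rw [hsrc] at hz
    refine hY.ext_frame (hBU hz) ?_ fun i => ?_
    · rw [inner_repFormula_gaussFormula, ← hFh hz]
      rfl
    · rw [inner_repFormula_pd (hW.hol_f.differentiableAt (Metric.isOpen_ball.mem_nhds hz))
        differentiableAt_id (hW.deriv_ne z hz), ← pd_congr_of_eqOn Metric.isOpen_ball hFh i hz,
        hY.pd_support (hBU hz)]
      rfl

theorem eq_zero_of_smul_stereo_eq {s : ℝ} (hs : s ≠ 0) {z : ℂ} {t : ℝ}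
    (h : s • stereo z = pt 0 t) : z = 0 := by
  obtain ⟨e0, e1, -⟩ := stereo_apply z
  have hT := (T_pos id z).ne'
  have h0 := congrArg (fun y : E3 => y 0) h
  have h1 := congrArg (fun y : E3 => y 1) h
  simp only [PiLp.smul_apply, e0, e1, smul_eq_mul] at h0 h1
  apply Complex.ext
  · simpa [pt, hs, hT] using h0
  · simpa [pt, hs, hT] using h1

/-- The points with `ψ ≠ 0` and `N⁺` not the south pole are dense, because a piece of surface with
`ψ = 0` would be a point; the relation, being closed, follows at the remaining points. -/
theorem isSS_of_ssAt [IsManifold 𝓘(ℝ, ℂ) ∞ S] (hX : IsImmersion X)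
    (hN : IsGaussMap X N) (hK : ∀ p, gaussCurvature X N p ≠ 0)
    (H : ∀ p, support X N p ≠ 0 → posNormal X N p ≠ pt 0 (-1) → SSAt X N p) : IsSS X N := by
  intro q
  -- One of the two normals at `q` is not the south pole.
  obtain ⟨s, hs, hsq⟩ : ∃ s : ℝ, (s = 1 ∨ s = -1) ∧ (s • N) q ≠ pt 0 (-1) := by
    by_cases h : N q = pt 0 (-1)
    · refine ⟨-1, Or.inr rfl, fun h' => ?_⟩
      rw [Pi.smul_apply, h] at h'
      have := congrArg (fun y : E3 => y 2) h'
      simp [pt] at this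
      norm_num at this
    · exact ⟨1, Or.inl rfl, by simpa using h⟩
  have hs2 : s ^ 2 = 1 := by rcases hs with rfl | rfl <;> norm_num
  have hN' := hN.smul hs
  have hSSs : ∀ p, SSAt X (s • N) p ↔ SSAt X N p := fun p => ssAt_smul hs2 (hN.mdifferentiableAt p)
  have hK' : ∀ p, gaussCurvature X (s • N) p ≠ 0 := fun p => by
    rw [gaussCurvature_smul hs2 (hN.mdifferentiableAt p)]
    exact hK p
  obtain ⟨φ, hφ, hqφ, hNφ⟩ := exists_param_of_gaussMap hN' hK' hsq
  have hU := φ.open_source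
  have hY := isConformalNormal_of_eqOn hX hN' hφ
    ((isWeierstrassData_id (differentiableOn_const 0)).isConformalSphereMap hU) hNφ
  have hiff : ∀ z ∈ φ.source, _ := fun z hz =>
    ssAt_iff_of_isConformalNormal hX hN' hφ hNφ hY hz
  have hz₀ := φ.map_target hqφ
  rw [← hSSs, ← φ.right_inv hqφ, hiff _ hz₀]
  -- Otherwise the left hand side is nonzero on an open set `O`, on which the support function must
  -- vanish off the point `z = 0`, where `N⁺` may be the south pole.
  by_contra hne
  have hO := (continuousOn_mul_laplacian_sub hU hY.smooth_support).isOpen_inter_preimage hU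
    (isOpen_ne (x := (0 : ℝ)))
  set O := φ.source ∩ (fun z => support (fun w => X (φ w)) (gaussFormula id) z
        * Laplacian.laplacian (support (fun w => X (φ w)) (gaussFormula id)) z
      - (pd 0 (support (fun w => X (φ w)) (gaussFormula id)) z ^ 2
        + pd 1 (support (fun w => X (φ w)) (gaussFormula id)) z ^ 2)) ⁻¹' {y | y ≠ 0}
  have hO' : IsOpen (O ∩ {0}ᶜ) := hO.inter isOpen_compl_singleton
  have hsub : O ∩ {0}ᶜ ⊆ φ.source := fun z hz => hz.1.1
  have hzero : ∀ z ∈ O ∩ {0}ᶜ, support (fun w => X (φ w)) (gaussFormula id) z = 0 := by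
    intro z hz
    by_contra hψ
    have hsup : support X (s • N) (φ z) = support (fun w => X (φ w)) (gaussFormula id) z := by
      rw [support, support, hNφ z hz.1.1]
    refine hz.1.2 ((hiff z hz.1.1).1 ((hSSs _).2 (H _ ?_ ?_)))
    · intro h0
      rw [← hsup, support_smul, h0, mul_zero] at hψ
      exact hψ rfl
    · rw [← posNormal_smul X N hs, posNormal, hNφ z hz.1.1, hsup]
      intro h
      refine hz.2 (eq_zero_of_smul_stereo_eq (fun h0 => hψ ?_) h)
      exact Real.sign_eq_zero_iff.1 h0
  obtain ⟨z, hz⟩ : (O ∩ {0}ᶜ).Nonempty :=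
    (dense_compl_singleton (0 : ℂ)).inter_open_nonempty O hO ⟨_, hz₀, hne⟩
  have hY' : IsConformalNormal (fun w => X (φ w)) (gaussFormula id) (O ∩ {0}ᶜ) :=
    { isOpen := hO'
      smooth := hY.smooth.mono hsub
      unit := fun w hw => hY.unit w (hsub hw)
      diag := fun w hw => hY.diag w (hsub hw)
      off_diag := fun w hw => hY.off_diag w (hsub hw)
      ne_zero := fun w hw => hY.ne_zero w (hsub hw)
      smooth_surface := hY.smooth_surface.mono hsub
      normal := fun w hw => hY.normal w (hsub hw) }
  have hconst : (fun w => X (φ w)) =ᶠ[𝓝 z] fun _ => 0 := by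
    filter_upwards [hO'.mem_nhds hz] with w hw using hY'.eq_zero_of_support_eq_zero hzero hw
  have hi := hφ.injective_fderiv_comp hX.smooth (hsub hz) (hX.injective _)
  rw [hconst.fderiv_eq] at hi
  have := @hi 1 0 (by simp)
  exact one_ne_zero this

end Surface

end SSSurface

theorem mainTheorem1 :
    -- The representation theorem for an immersed Riemann surface with nonzero curvature.
    (∀ {S : Type*} [TopologicalSpace S] [ChartedSpace ℂ S] [IsManifold 𝓘(ℂ) ω S]
      (X N : S → SSSurface.E3),
      SSSurface.IsImmersion X → SSSurface.IsGaussMap X N →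
      (∀ p, SSSurface.gaussCurvature X N p ≠ 0) →
      -- SS-surface if and only if locally given by the formula
      (SSSurface.IsSS X N ↔
        ∀ p, SSSurface.support X N p ≠ 0 → SSSurface.posNormal X N p ≠ SSSurface.pt 0 (-1) →
          ∃ (φ : OpenPartialHomeomorph ℂ S) (f g : ℂ → ℂ),
            p ∈ φ.target ∧ SSSurface.IsRepresentation X φ f g) ∧
      -- Gauss map, support function and regularity condition in every such representation
      (∀ (φ : OpenPartialHomeomorph ℂ S) (f g : ℂ → ℂ), SSSurface.IsRepresentation X φ f g →
        ∀ z ∈ φ.source,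
          SSSurface.SSAt X N (φ z) ∧
          SSSurface.support X N (φ z) ≠ 0 ∧
          SSSurface.posNormal X N (φ z) = SSSurface.gaussFormula g z ∧
          |SSSurface.support X N (φ z)| = SSSurface.hFun f z ∧
          (SSSurface.matV (SSSurface.hFun f) (SSSurface.gaussFormula g) z).det
            = 1 / SSSurface.gaussCurvature X N (φ z) ∧
          (SSSurface.matV (SSSurface.hFun f) (SSSurface.gaussFormula g) z).det ≠ 0) ∧
      -- the SS condition as a differential equation for the support function, in parameters
      -- that are conformal for the third fundamental form
      (∀ φ : OpenPartialHomeomorph ℂ S, SSSurface.IsSmoothParam φ →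
        (∀ z ∈ φ.source,
          SSSurface.metricL (fun w => N (φ w)) 0 0 z = SSSurface.metricL (fun w => N (φ w)) 1 1 z ∧
          SSSurface.metricL (fun w => N (φ w)) 0 1 z = 0) →
        (∀ z ∈ φ.source,
          (SSSurface.SSAt X N (φ z) ↔
            SSSurface.support X N (φ z)
                * Laplacian.laplacian (fun w => SSSurface.support X N (φ w)) z
              - ((SSSurface.pd 0 (fun w => SSSurface.support X N (φ w)) z) ^ 2
                + (SSSurface.pd 1 (fun w => SSSurface.support X N (φ w)) z) ^ 2) = 0)) ∧
        ((∀ z ∈ φ.source, SSSurface.support X N (φ z) ≠ 0) →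
          ((∀ z ∈ φ.source, SSSurface.SSAt X N (φ z)) ↔
            InnerProductSpace.HarmonicOnNhd
              (fun w => Real.log |SSSurface.support X N (φ w)|) φ.source)))) ∧
    -- The geometry of the map given by the formula.
    (∀ (U : Set ℂ) (f g : ℂ → ℂ), IsOpen U → SSSurface.IsWeierstrassData f g U →
      ContDiffOn ℝ ∞ (SSSurface.repFormula f g) U ∧
      ContDiffOn ℝ ∞ (SSSurface.gaussFormula g) U ∧
      ∀ z ∈ U, ∀ X N : ℂ → SSSurface.E3, X = SSSurface.repFormula f g →
        N = SSSurface.gaussFormula g →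
        ∀ h T A B C ℓ : ℝ, h = Real.exp (f z).re → T = 1 + ‖g z‖ ^ 2 →
        A = (deriv f z).re ^ 2 - (SSSurface.xi f g z).re →
        B = (SSSurface.xi f g z - deriv f z ^ 2 / 2).im →
        C = (Complex.I * deriv f z).re ^ 2 + (SSSurface.xi f g z).re →
        ℓ = ‖deriv g z‖ ^ 2 →
        -- unit normal and support function
        ‖N z‖ = 1 ∧
        (∀ i, inner ℝ (SSSurface.pd i X z) (N z) = 0) ∧
        SSSurface.support X N z = h ∧
        -- regularity condition
        (Function.Injective (fderiv ℝ X z) ↔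
          (SSSurface.matV (SSSurface.hFun f) N z).det ≠ 0) ∧
        ((SSSurface.matV (SSSurface.hFun f) N z).det ≠ 0 →
          (SSSurface.matV (SSSurface.hFun f) N z).det = 1 / SSSurface.gaussCurvature X N z ∧
          SSSurface.gaussCurvature X N z ≠ 0) ∧
        -- fundamental forms
        SSSurface.firstForm X z 0 0
          = T ^ 2 * h ^ 2 / (4 * ℓ) * (A ^ 2 + B ^ 2) + 2 * h ^ 2 * A + 4 * h ^ 2 * ℓ / T ^ 2 ∧
        SSSurface.firstForm X z 0 1
          = (T ^ 2 * h ^ 2 * ‖deriv f z‖ ^ 2 / (4 * ℓ) + 2 * h ^ 2) * B ∧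
        SSSurface.firstForm X z 1 1
          = T ^ 2 * h ^ 2 / (4 * ℓ) * (C ^ 2 + B ^ 2) + 2 * h ^ 2 * C + 4 * h ^ 2 * ℓ / T ^ 2 ∧
        SSSurface.secondForm X N z 0 0 = h * A + 4 * h * ℓ / T ^ 2 ∧
        SSSurface.secondForm X N z 0 1 = h * B ∧
        SSSurface.secondForm X N z 1 1 = h * C + 4 * h * ℓ / T ^ 2) := by
  refine ⟨?_, ?_⟩
  · intro S _ _ _ X N hX hN hK
    have := SSSurface.isManifold_real S
    refine ⟨⟨fun hSS p hψ hp => ?_, fun H => ?_⟩, fun φ f g h z hz => h.properties hX hN hz,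
      fun φ hφ hd => ?_⟩
    · -- Replace `N` by the constant multiple `sign (ψ p) • N`, which is `N⁺` at `p`.
      have hs : Real.sign (SSSurface.support X N p) = 1
          ∨ Real.sign (SSSurface.support X N p) = -1 := (Real.sign_apply_eq_of_ne_zero _ hψ).symm
      have hs2 : Real.sign (SSSurface.support X N p) ^ 2 = 1 := by
        rcases hs with h | h <;> rw [h] <;> norm_num
      refine SSSurface.exists_isRepresentation hX (hN.smul hs) (fun q => ?_) (fun q => ?_) ?_ hp
      · rw [SSSurface.gaussCurvature_smul hs2 (hN.mdifferentiableAt q)]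
        exact hK q
      · exact (SSSurface.ssAt_smul hs2 (hN.mdifferentiableAt q)).2 (hSS q)
      · rw [SSSurface.support_smul]
        exact Real.sign_mul_pos_of_ne_zero _ hψ
    · refine SSSurface.isSS_of_ssAt hX hN hK fun p hψ hp => ?_
      obtain ⟨φ, f, g, hpφ, h⟩ := H p hψ hp
      rw [← φ.right_inv hpφ]
      exact (h.properties hX hN (φ.map_target hpφ)).1
    · have hY := SSSurface.isConformalNormal_of_eqOn hX hN hφ
        (SSSurface.isConformalSphereMap_comp hN hK hφ hd) fun _ _ => rfl
      have hiff := fun z (hz : z ∈ φ.source) =>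
        SSSurface.ssAt_iff_of_isConformalNormal hX hN hφ (fun _ _ => rfl) hY hz
      refine ⟨hiff, fun h0 => ?_⟩
      exact (forall₂_congr hiff).trans
        (SSSurface.harmonicOnNhd_log_abs_iff φ.open_source hY.smooth_support h0).symm
  · intro U f g hU hfg
    have hR := hfg.isConformalNormal hU
    refine ⟨hR.smooth_surface, hR.smooth, ?_⟩
    intro z hz X N hX hN h T A B C ℓ hh hT hA hB hC hℓ
    subst hX hN
    have hl : SSSurface.metricL (SSSurface.gaussFormula g) 0 0 z = 4 * ℓ / T ^ 2 := by
      rw [SSSurface.metricL_gaussFormula (hfg.hol_g.differentiableAt (hU.mem_nhds hz)), hℓ, hT]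
      rfl
    have hl0 := hR.ne_zero z hz
    obtain ⟨v00, v01, v11⟩ := hfg.metricL_mul_matV hU hz
    have hh' : SSSurface.hFun f z = h := hh.symm
    have hsymm := hR.matV_symm hz
    have hI := hR.firstForm_eq hz
    have hII := hR.secondForm_eq hz
    have hinj := hR.injective_iff hz
    have hGK := hR.gaussCurvature_eq hz
    -- Both fundamental forms are expressed through `V`, and `V` through `A`, `B`, `C`.
    rw [SSSurface.support_repFormula] at hsymm hI hII hinj hGK
    rw [hh', ← hA] at v00
    rw [hh', ← hB] at v01
    rw [hh', ← hC] at v11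
    have hAC : A + C = ‖deriv f z‖ ^ 2 := by
      rw [hA, hC, ← Complex.normSq_eq_norm_sq, Complex.normSq_apply]
      simp
      ring
    have hℓ0 : ℓ ≠ 0 := by
      rw [hℓ]
      exact pow_ne_zero 2 (norm_ne_zero_iff.2 (hfg.deriv_ne z hz))
    have hT0 : T ≠ 0 := hT ▸ (SSSurface.T_pos g z).ne'
    rw [hI, hII, ← hAC]
    generalize SSSurface.matV (SSSurface.hFun f) (SSSurface.gaussFormula g) z = V at *
    rw [hl] at v00 v01 v11 hl0
    have w00 : V 0 0 = h * (A + 4 * ℓ / T ^ 2) / (4 * ℓ / T ^ 2) := by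
      rw [eq_div_iff hl0, ← v00, mul_comm]
    have w01 : V 0 1 = h * B / (4 * ℓ / T ^ 2) := by rw [eq_div_iff hl0, ← v01, mul_comm]
    have w11 : V 1 1 = h * (C + 4 * ℓ / T ^ 2) / (4 * ℓ / T ^ 2) := by
      rw [eq_div_iff hl0, ← v11, mul_comm]
    refine ⟨hR.unit z hz, fun i => hR.normal z hz i, ?_, hinj, fun hV => ?_, ?_, ?_, ?_, ?_, ?_, ?_⟩
    · rw [SSSurface.support_repFormula, hh']
    · rw [hGK hV, one_div_one_div]
      exact ⟨rfl, one_div_ne_zero hV⟩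
    all_goals
      simp only [Matrix.smul_apply, Matrix.mul_apply, Matrix.transpose_apply, Fin.sum_univ_two,
        smul_eq_mul, hsymm, hl, w00, w01, w11]
      field_simp
    all_goals ring
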